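/- Let $1<p<\infty$, $K\in\mathbb R$, $N>1$ and $D>0$. Put $D_{K,N}=\pi/\sqrt{K/(N-1)}$ if $K>0$ and $D_{K,N}=+\infty$ if $K\le 0$, and assume $D\le D_{K,N}$. **Densities.** For $t\in[0,1]$, $\theta\ge 0$ let $\sigma^{(t)}_{K,N-1}(\theta)\in[0,\infty]$ be $+\infty$ if $K\theta^2\ge (N-1)\pi^2$; $\dfrac{\sin(t\theta\sqrt{K/(N-1)})}{\sin(\theta\sqrt{K/(N-1)})}$ if $0<K\theta^2<(N-1)\pi^2$; $t$ if $K\theta^2=0$; and $\dfrac{\sinh(t\theta\sqrt{-K/(N-1)})}{\sinh(\theta\sqrt{-K/(N-1)})}$ if $K\theta^2<0$. Let $\mathcal F_{K,N,D}$ be the set of $\mathrm{MCP}(K,N)$ densities with support $[0,D]$, i.e. of the non-negative integrable Borel functions $h:\mathbb R\to\mathbb R$ with $\operatorname{supp}h=[0,D]$ and $$h(tx_1+(1-t)x_0)\ \ge\ \sigma^{(1-t)}_{K,N-1}(|x_1-x_0|)^{N-1}\,h(x_0)\qquad\text{for all }x_0,x_1\in\operatorname{supp}h,\ t\in[0,1]$$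 (with $\infty\cdot 0=0$). The $p$-spectral gap of $h$ is $$\lambda^{p,h}=\inf\left\{\frac{\int |u'|^p h\,dx}{\int |u|^p h\,dx}:\ u\in \mathrm{Lip}(\operatorname{supp} h)\cap L^p(h\,dx),\ u\not\equiv 0\text{ on }\operatorname{supp}h,\ \int u|u|^{p-2}h\,dx=0\right\}.$$ **Generalized trigonometric functions.** Let $\pi_p=\int_{-1}^1 (1-|r|^p)^{-1/p}\,dr$. Let $\sin_p$ be the $2\pi_p$-periodic function on $\mathbb R$ which on $[-\pi_p/2,\pi_p/2]$ is the inverse of $s\mapsto\int_0^s(1-|r|^p)^{-1/p}\,dr$, $s\in[-1,1]$, and which satisfies $\sin_p(t)=\sin_p(\pi_p-t)$ on $[\pi_p/2,3\pi_p/2]$. Let $\cos_p=\sin_p'$, and let $\cos_p^{p-1}$ denote the signed power $|\cos_p|^{p-2}\cos_p$. **Model equation.** Let $\cot_{K,N}(x)$ be $\sqrt{K(N-1)}\cot\big(\sqrt{K/(N-1)}\,x\big)$ if $K>0$, $(N-1)/x$ if $K=0$, and $\sqrt{-K(N-1)}\coth\big(\sqrt{-K/(N-1)}\,x\big)$ if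 $K<0$. Let $T_{K,N,D}(x)=-\cot_{K,N}(D-x)$ for $x<D/2$ and $T_{K,N,D}(x)=\cot_{K,N}(x)$ for $x\ge D/2$. Consider, for $\lambda\ge 0$, the problem of finding $\varphi$ continuous on $[0,D]$ and differentiable on $(0,D)$ with $$\varphi'=\Big(\frac{\lambda}{p-1}\Big)^{1/p}+\frac1{p-1}\,T_{K,N,D}\,\cos_p^{p-1}(\varphi)\,\sin_p(\varphi)\ \text{ on }(0,D),\qquad \varphi(0)=-\frac{\pi_p}2,\quad \varphi\Big(\frac D2\Big)=0,\quad \varphi(D)=\frac{\pi_p}2 .\tag{$*$}$$ **Theorem.** There is a least $\lambda\ge0$ for which $(*)$ has a solution; call it $\hat\lambda^p_{K,N,D}$. Then $\lambda^{p,h}\ge\hat\lambda^p_{K,N,D}$ for every $h\in\mathcal F_{K,N,D}$. -/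

import Mathlib

open MeasureTheory

namespace MCPGap

noncomputable section

/-! ### One-dimensional `MCP(K,N)` densities -/

/-- The distortion coefficient `σ_{K,n}^{(t)}(θ) ∈ [0,∞]` with curvature parameter `K / n`
(it is used with `n = N - 1`). -/
def sigma (K n t θ : ℝ) : ENNReal :=
  if n * Real.pi ^ 2 ≤ K * θ ^ 2 then ⊤
  else if 0 < K * θ ^ 2 then
    ENNReal.ofReal (Real.sin (t * θ * √(K / n)) / Real.sin (θ * √(K / n)))
  else if K * θ ^ 2 = 0 then ENNReal.ofReal t
  else ENNReal.ofReal (Real.sinh (t * θ * √(-K / n)) / Real.sinh (θ * √(-K / n)))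

/-- `h` is an `MCP(K,N)` density: a non-negative integrable Borel function with
`h(t x₁ + (1-t) x₀) ≥ σ_{K,N-1}^{(1-t)}(|x₁-x₀|)^{N-1} h(x₀)` for `x₀, x₁ ∈ supp h`.
The inequality is read in `[0,∞]`, where `∞ · 0 = 0`. -/
structure IsMCPDensity (K N : ℝ) (h : ℝ → ℝ) : Prop where
  measurable : Measurable h
  nonneg : ∀ x, 0 ≤ h x
  integrable : Integrable h
  contraction : ∀ x₀ ∈ tsupport h, ∀ x₁ ∈ tsupport h, ∀ t ∈ Set.Icc (0 : ℝ) 1,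
    sigma K (N - 1) (1 - t) |x₁ - x₀| ^ (N - 1) * ENNReal.ofReal (h x₀)
      ≤ ENNReal.ofReal (h (t * x₁ + (1 - t) * x₀))

/-- The Bonnet–Myers diameter bound `D_{K,N}`. -/
def diamBound (K N : ℝ) : EReal :=
  if 0 < K then ((Real.pi / √(K / (N - 1)) : ℝ) : EReal) else ⊤

/-- `𝓕_{K,N,D}`: the `MCP(K,N)` densities with support `[0, min (D, D_{K,N})]`. -/
def densities (K N D : ℝ) : Set (ℝ → ℝ) :=
  {h | IsMCPDensity K N h ∧
    tsupport h = {x : ℝ | 0 ≤ x ∧ x ≤ D ∧ (x : EReal) ≤ diamBound K N}}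

/-! ### The `p`-spectral gap of a density -/

/-- The admissible functions: Lipschitz on `supp h`, in `L^p(h dx)`, not identically zero on
`supp h`, with `∫ u |u|^{p-2} h dx = 0`. -/
def Admissible (p : ℝ) (h u : ℝ → ℝ) : Prop :=
  (∃ C : NNReal, LipschitzOnWith C u (tsupport h)) ∧
  MemLp u (ENNReal.ofReal p) (volume.withDensity fun x => ENNReal.ofReal (h x)) ∧
  (∃ x ∈ tsupport h, u x ≠ 0) ∧
  ∫ x, u x * |u x| ^ (p - 2) * h x = 0

/-- The `p`-spectral gap `λ^{p,h}`, the infimum of the Rayleigh quotients. -/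
def spectralGap (p : ℝ) (h : ℝ → ℝ) : ℝ :=
  sInf {q : ℝ | ∃ u : ℝ → ℝ, Admissible p h u ∧
    q = (∫ x, |deriv u x| ^ p * h x) / (∫ x, |u x| ^ p * h x)}

/-! ### Generalized trigonometric functions -/

/-- `s ↦ ∫_0^s dr / (1 - |r|^p)^{1/p}`, for `s ∈ [-1,1]`. -/
def arcsinP (p s : ℝ) : ℝ :=
  ∫ r in (0 : ℝ)..s, 1 / (1 - |r| ^ p) ^ (1 / p)

/-- `π_p`. -/
def piP (p : ℝ) : ℝ :=
  ∫ r in (-1 : ℝ)..1, 1 / (1 - |r| ^ p) ^ (1 / p)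

/-- `t` reduced modulo `2 π_p` to `[-π_p/2, 3π_p/2)`. -/
def reduceP (p t : ℝ) : ℝ :=
  t - 2 * piP p * ⌊(t + piP p / 2) / (2 * piP p)⌋

/-- `sin_p`: on `[-π_p/2, π_p/2]` the inverse of `arcsinP p` on `[-1,1]`; on
`[π_p/2, 3π_p/2]` given by `sin_p t = sin_p (π_p - t)`; and `2 π_p`-periodic. -/
def sinP (p t : ℝ) : ℝ :=
  if reduceP p t ≤ piP p / 2 then
    Function.invFunOn (arcsinP p) (Set.Icc (-1) 1) (reduceP p t)
  else
    Function.invFunOn (arcsinP p) (Set.Icc (-1) 1) (piP p - reduceP p t)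

/-- `cos_p`, the derivative of `sin_p`. -/
def cosP (p : ℝ) : ℝ → ℝ := deriv (sinP p)

/-! ### The model equation -/

/-- `cot_{K,N}`. -/
def cotKN (K N x : ℝ) : ℝ :=
  if 0 < K then √(K * (N - 1)) * Real.cot (√(K / (N - 1)) * x)
  else if K = 0 then (N - 1) / x
  else √(-K * (N - 1)) *
    (Real.cosh (√(-K / (N - 1)) * x) / Real.sinh (√(-K / (N - 1)) * x))

/-- `T_{K,N,D}`, the logarithmic derivative of the model density. Its value at the jump `D/2`
plays no role below, since it gets multiplied by `sin_p 0 = 0`. -/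
def modelT (K N D x : ℝ) : ℝ :=
  if x < D / 2 then -cotKN K N (D - x) else cotKN K N x

/-- `φ` solves the boundary value problem
`φ' = (λ/(p-1))^{1/p} + (1/(p-1)) T_{K,N,D} cos_p^{p-1}(φ) sin_p(φ)` on `(0, D)`,
`φ(0) = -π_p/2`, `φ(D/2) = 0`, `φ(D) = π_p/2`, and is continuous up to the boundary.
Here `cos_p^{p-1}` is the signed power `|cos_p|^{p-2} cos_p`. -/
structure IsModelSolution (p K N D lam : ℝ) (φ : ℝ → ℝ) : Prop where
  continuousOn : ContinuousOn φ (Set.Icc 0 D)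
  ode : ∀ x ∈ Set.Ioo 0 D, HasDerivAt φ
    ((lam / (p - 1)) ^ (1 / p)
      + 1 / (p - 1) * modelT K N D x
        * (|cosP p (φ x)| ^ (p - 2) * cosP p (φ x)) * sinP p (φ x)) x
  left : φ 0 = -(piP p / 2)
  mid : φ (D / 2) = 0
  right : φ D = piP p / 2

/-- The parameters `λ ≥ 0` for which the model problem has a solution. -/
def modelParameters (p K N D : ℝ) : Set ℝ :=
  {lam | 0 ≤ lam ∧ ∃ φ : ℝ → ℝ, IsModelSolution p K N D lam φ}

/-- `\hat λ^p_{K,N,D}`. -/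
def lambdaHat (p K N D : ℝ) : ℝ := sInf (modelParameters p K N D)

end

end MCPGap

/-! The equation is odd under reflection about `D / 2`, so it reduces to a phase equation on `[D/2,
D]`: `φ' = α + cot_{K,N} F(φ) / (p - 1)` with `F = cos_p^{p-1} sin_p`, `φ(D/2) = 0`, `φ(D) = π_p/2`
and `λ = (p - 1) α ^ p`. Here `φ` is the Prüfer angle of an eigenfunction for the weight `m = snKN ^
(N - 1)`, with a Dirichlet condition at `D / 2` and a Neumann condition at `D`. A shooting argument
in `α` produces a solution (`exists_phase_reaching`), and comparison shows that no smaller parameter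
works (`le_of_phase_reaching`). When `K > 0` and `D = D_{K,N}` the coefficient tends to `-∞` at `D`,
so only its upper bound is used there.

For the spectral gap, put `r = α cos_p φ / sin_p φ`, the logarithmic derivative of the
eigenfunction. It solves a Riccati equation, and `picone` gives `∫_{D/2}^t m (|v'|^p - λ |v|^p) ≥ 0`
for every `t < D` whenever `v(D/2) = 0`; the boundary term at `t` has the good sign because `φ <
π_p/2` there. Having this for all `t` is what matters: it survives multiplication by a nonincreasing
factor (`integral_antitoneOn_mul_nonneg`). The MCP condition with pole `0` says precisely that `h /
m` is nonincreasing, and with pole `D` the same for the reflected density. So both halves of `[0,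
D]` satisfy the inequality with `h` in place of `m`.

Finally, for `u` with `∫ u |u|^{p-2} h = 0`, apply this to `v = u - u(D/2)`. The derivative is
unchanged, and by convexity the `p`-mean condition makes `∫ |u|^p h ≤ ∫ |v|^p h`. No information on
the zeros of `u` is needed. -/

namespace MCPGap

/-! ### Generalized sine -/

section Trig

variable {p : ℝ}

lemma one_sub_abs_rpow_pos (hp : 1 < p) {r : ℝ} (hr : |r| < 1) : 0 < 1 - |r| ^ p := by
  have := Real.rpow_lt_one (abs_nonneg r) hr (by linarith : 0 < p)
  linarith

lemma one_le_arcsinP_integrand (hp : 1 < p) {r : ℝ} (hr : |r| < 1) :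
    1 ≤ 1 / (1 - |r| ^ p) ^ (1 / p) := by
  have h0 := one_sub_abs_rpow_pos hp hr
  have h1 : 0 < (1 - |r| ^ p) ^ (1 / p) := Real.rpow_pos_of_pos h0 _
  rw [le_div_iff₀ h1, one_mul]
  refine Real.rpow_le_one h0.le ?_ (by positivity)
  have : 0 ≤ |r| ^ p := by positivity
  linarith

lemma intervalIntegrable_arcsinP_integrand (hp : 1 < p) :
    IntervalIntegrable (fun r : ℝ => 1 / (1 - |r| ^ p) ^ (1 / p)) volume (-1) 1 := by
  have hmeas : Measurable (fun r : ℝ => 1 / (1 - |r| ^ p) ^ (1 / p)) := by fun_prop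
  have key : IntervalIntegrable (fun r : ℝ => 1 / (1 - |r| ^ p) ^ (1 / p)) volume 0 1 := by
    -- Since `r ^ p ≤ r` on `(0,1)`, the singularity at `1` is no worse than `(1 - r) ^ (-1/p)`, and
    -- `1 / p < 1`.
    have h1 : IntervalIntegrable (fun r : ℝ => (1 - r) ^ (-(1 / p))) volume 0 1 := by
      have : -1 < -(1 / p) := by
        have : 1 / p < 1 := by rw [div_lt_one (by linarith)]; exact hp
        linarith
      have h := (intervalIntegral.intervalIntegrable_rpow' (a := 0) (b := 1) this).comp_sub_left 1
      simpa using h.symm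
    refine h1.mono_fun' hmeas.aestronglyMeasurable ?_
    rw [Set.uIoc_of_le zero_le_one, ← Measure.restrict_congr_set Ioo_ae_eq_Ioc]
    filter_upwards [ae_restrict_mem measurableSet_Ioo] with r hr
    have hr' : |r| = r := abs_of_pos hr.1
    have h0 := one_sub_abs_rpow_pos hp (r := r) (by rw [hr']; exact hr.2)
    rw [Real.norm_of_nonneg (by positivity), Real.rpow_neg (by linarith [hr.2]), one_div]
    refine inv_anti₀ (Real.rpow_pos_of_pos (by linarith [hr.2]) _) ?_
    refine Real.rpow_le_rpow (by linarith [hr.2]) ?_ (by positivity)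
    have : r ^ p ≤ r ^ (1 : ℝ) := Real.rpow_le_rpow_of_exponent_ge hr.1 hr.2.le hp.le
    rw [Real.rpow_one] at this
    rw [hr']; linarith
  have key2 : IntervalIntegrable (fun r : ℝ => 1 / (1 - |r| ^ p) ^ (1 / p)) volume (-1) 0 := by
    have := key.comp_sub_left 0
    simp only [zero_sub, abs_neg, sub_zero] at this
    exact this.symm
  exact key2.trans key

lemma intervalIntegrable_arcsinP_integrand' (hp : 1 < p) {s t : ℝ} (hs : s ∈ Set.Icc (-1 : ℝ) 1)
    (ht : t ∈ Set.Icc (-1 : ℝ) 1) :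
    IntervalIntegrable (fun r : ℝ => 1 / (1 - |r| ^ p) ^ (1 / p)) volume s t := by
  refine (intervalIntegrable_arcsinP_integrand hp).mono_set ?_
  rw [Set.uIcc_of_le (by norm_num : (-1 : ℝ) ≤ 1)]
  exact Set.uIcc_subset_Icc hs ht

lemma arcsinP_zero : arcsinP p 0 = 0 := by simp [arcsinP]

lemma arcsinP_neg (s : ℝ) : arcsinP p (-s) = -arcsinP p s := by
  unfold arcsinP
  have := intervalIntegral.integral_comp_neg (a := 0) (b := s)
    (fun r : ℝ => 1 / (1 - |r| ^ p) ^ (1 / p))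
  simp only [abs_neg, neg_zero] at this
  rw [this, intervalIntegral.integral_symm]

/-- The integrand is at least `1`. This one estimate yields strict monotonicity, `π_p ≥ 2` and the
fact that `sin_p` is 1-Lipschitz on its main branch. -/
lemma sub_le_arcsinP_sub (hp : 1 < p) {s t : ℝ} (hs : -1 ≤ s) (hst : s ≤ t) (ht : t ≤ 1) :
    t - s ≤ arcsinP p t - arcsinP p s := by
  unfold arcsinP
  have h0 : (0 : ℝ) ∈ Set.Icc (-1 : ℝ) 1 := by constructor <;> norm_num
  have hs' : s ∈ Set.Icc (-1 : ℝ) 1 := ⟨hs, hst.trans ht⟩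
  have ht' : t ∈ Set.Icc (-1 : ℝ) 1 := ⟨hs.trans hst, ht⟩
  rw [intervalIntegral.integral_interval_sub_left
    (intervalIntegrable_arcsinP_integrand' hp h0 ht')
    (intervalIntegrable_arcsinP_integrand' hp h0 hs')]
  have : t - s = ∫ r in s..t, (1 : ℝ) := by simp
  rw [this]
  refine intervalIntegral.integral_mono_on_of_le_Ioo hst (by simp)
    (intervalIntegrable_arcsinP_integrand' hp hs' ht') fun r hr => ?_
  exact one_le_arcsinP_integrand hp (abs_lt.2 ⟨by linarith [hr.1], by linarith [hr.2]⟩)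

lemma strictMonoOn_arcsinP (hp : 1 < p) : StrictMonoOn (arcsinP p) (Set.Icc (-1) 1) := by
  intro s hs t ht hst
  have := sub_le_arcsinP_sub hp hs.1 hst.le ht.2
  linarith

lemma continuousOn_arcsinP (hp : 1 < p) : ContinuousOn (arcsinP p) (Set.Icc (-1) 1) := by
  have h0 : (0 : ℝ) ∈ Set.uIcc (-1 : ℝ) 1 := by
    rw [Set.uIcc_of_le (by norm_num)]; constructor <;> norm_num
  have := intervalIntegral.continuousOn_primitive_interval'
    (intervalIntegrable_arcsinP_integrand hp) h0
  rwa [Set.uIcc_of_le (by norm_num : (-1 : ℝ) ≤ 1)] at this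

lemma arcsinP_one (hp : 1 < p) : arcsinP p 1 = piP p / 2 := by
  have h0 : (0 : ℝ) ∈ Set.Icc (-1 : ℝ) 1 := by constructor <;> norm_num
  have : piP p = arcsinP p 1 - arcsinP p (-1) := by
    unfold arcsinP piP
    rw [intervalIntegral.integral_interval_sub_left]
    · exact intervalIntegrable_arcsinP_integrand' hp h0 (by simp)
    · exact intervalIntegrable_arcsinP_integrand' hp h0 (by simp)
  rw [this, arcsinP_neg]; ring

lemma one_le_piP_half (hp : 1 < p) : 1 ≤ piP p / 2 := by
  rw [← arcsinP_one hp]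
  have := sub_le_arcsinP_sub hp (s := 0) (t := 1) (by norm_num) (by norm_num) le_rfl
  rw [arcsinP_zero] at this
  linarith

lemma hasDerivAt_arcsinP (hp : 1 < p) {s : ℝ} (hs : s ∈ Set.Ioo (-1 : ℝ) 1) :
    HasDerivAt (arcsinP p) (1 / (1 - |s| ^ p) ^ (1 / p)) s := by
  have h0 : (0 : ℝ) ∈ Set.Icc (-1 : ℝ) 1 := by constructor <;> norm_num
  refine intervalIntegral.integral_hasDerivAt_right
    (intervalIntegrable_arcsinP_integrand' hp h0 ⟨hs.1.le, hs.2.le⟩) ?_ ?_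
  · exact Measurable.stronglyMeasurable (by fun_prop) |>.stronglyMeasurableAtFilter
  · have h1 := one_sub_abs_rpow_pos hp (abs_lt.2 hs)
    have h2 : (1 - |s| ^ p) ^ (1 / p) ≠ 0 := (Real.rpow_pos_of_pos h1 _).ne'
    refine ContinuousAt.div continuousAt_const ?_ h2
    refine ContinuousAt.rpow_const ?_ (Or.inl h1.ne')
    refine continuousAt_const.sub ?_
    exact (continuous_abs.continuousAt).rpow_const (Or.inr (by linarith))

lemma reduceP_eq_self (hp : 1 < p) {y : ℝ} (hy : y ∈ Set.Icc (-(piP p / 2)) (piP p / 2)) :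
    reduceP p y = y := by
  have h1 := one_le_piP_half hp
  have : ⌊(y + piP p / 2) / (2 * piP p)⌋ = 0 := by
    rw [Int.floor_eq_zero_iff]
    constructor
    · exact div_nonneg (by linarith [hy.1]) (by linarith)
    · rw [div_lt_one (by linarith)]; linarith [hy.2]
  rw [reduceP, this]; simp

lemma arcsinP_mem (hp : 1 < p) {s : ℝ} (hs : s ∈ Set.Icc (-1 : ℝ) 1) :
    arcsinP p s ∈ Set.Icc (-(piP p / 2)) (piP p / 2) := by
  have hm := (strictMonoOn_arcsinP hp).monotoneOn
  constructor
  · rw [← arcsinP_one hp, ← arcsinP_neg]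
    exact hm (by simp) hs hs.1
  · rw [← arcsinP_one hp]
    exact hm hs (by simp) hs.2

lemma sinP_arcsinP (hp : 1 < p) {s : ℝ} (hs : s ∈ Set.Icc (-1 : ℝ) 1) :
    sinP p (arcsinP p s) = s := by
  have h := arcsinP_mem hp hs
  rw [sinP, reduceP_eq_self hp h, if_pos h.2]
  exact (strictMonoOn_arcsinP hp).injOn.leftInvOn_invFunOn hs

lemma exists_arcsinP_eq (hp : 1 < p) {y : ℝ} (hy : y ∈ Set.Icc (-(piP p / 2)) (piP p / 2)) :
    ∃ s ∈ Set.Icc (-1 : ℝ) 1, arcsinP p s = y := by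
  have := intermediate_value_Icc (by norm_num : (-1 : ℝ) ≤ 1) (continuousOn_arcsinP hp)
  rw [arcsinP_neg, arcsinP_one hp] at this
  exact this hy

lemma sinP_mem (hp : 1 < p) {y : ℝ} (hy : y ∈ Set.Icc (-(piP p / 2)) (piP p / 2)) :
    sinP p y ∈ Set.Icc (-1 : ℝ) 1 := by
  obtain ⟨s, hs, rfl⟩ := exists_arcsinP_eq hp hy
  rwa [sinP_arcsinP hp hs]

lemma arcsinP_sinP (hp : 1 < p) {y : ℝ} (hy : y ∈ Set.Icc (-(piP p / 2)) (piP p / 2)) :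
    arcsinP p (sinP p y) = y := by
  obtain ⟨s, hs, rfl⟩ := exists_arcsinP_eq hp hy
  rw [sinP_arcsinP hp hs]

lemma sinP_neg (hp : 1 < p) {y : ℝ} (hy : y ∈ Set.Icc (-(piP p / 2)) (piP p / 2)) :
    sinP p (-y) = -sinP p y := by
  obtain ⟨s, hs, rfl⟩ := exists_arcsinP_eq hp hy
  rw [sinP_arcsinP hp hs, ← arcsinP_neg, sinP_arcsinP hp ⟨by linarith [hs.2], by linarith [hs.1]⟩]

lemma sinP_zero (hp : 1 < p) : sinP p 0 = 0 := by
  have := sinP_arcsinP hp (s := 0) (by constructor <;> norm_num)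
  rwa [arcsinP_zero] at this

lemma sinP_piP_half (hp : 1 < p) : sinP p (piP p / 2) = 1 := by
  have := sinP_arcsinP hp (s := 1) (by constructor <;> norm_num)
  rwa [arcsinP_one hp] at this

lemma strictMonoOn_sinP (hp : 1 < p) :
    StrictMonoOn (sinP p) (Set.Icc (-(piP p / 2)) (piP p / 2)) := by
  intro x hx y hy hxy
  by_contra! h
  have := (strictMonoOn_arcsinP hp).monotoneOn (sinP_mem hp hy) (sinP_mem hp hx) h
  rw [arcsinP_sinP hp hx, arcsinP_sinP hp hy] at this
  linarith

lemma sinP_sub_le (hp : 1 < p) {x y : ℝ} (hx : x ∈ Set.Icc (-(piP p / 2)) (piP p / 2))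
    (hy : y ∈ Set.Icc (-(piP p / 2)) (piP p / 2)) (hxy : x ≤ y) :
    sinP p y - sinP p x ≤ y - x := by
  have h := sub_le_arcsinP_sub hp (sinP_mem hp hx).1
    ((strictMonoOn_sinP hp).monotoneOn hx hy hxy) (sinP_mem hp hy).2
  rwa [arcsinP_sinP hp hx, arcsinP_sinP hp hy] at h

lemma continuousOn_sinP (hp : 1 < p) :
    ContinuousOn (sinP p) (Set.Icc (-(piP p / 2)) (piP p / 2)) := by
  have : LipschitzOnWith 1 (sinP p) (Set.Icc (-(piP p / 2)) (piP p / 2)) := by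
    refine LipschitzOnWith.of_le_add fun x hx y hy => ?_
    rcases le_total x y with h | h
    · have := (strictMonoOn_sinP hp).monotoneOn hx hy h
      have := dist_nonneg (x := x) (y := y)
      linarith
    · have := sinP_sub_le hp hy hx h
      have := le_abs_self (x - y)
      rw [Real.dist_eq]
      linarith
  exact this.continuousOn

lemma sinP_mem_Ioo (hp : 1 < p) {y : ℝ} (hy : y ∈ Set.Ioo (-(piP p / 2)) (piP p / 2)) :
    sinP p y ∈ Set.Ioo (-1 : ℝ) 1 := by
  have h1 := one_le_piP_half hp
  have hy' := Set.Ioo_subset_Icc_self hy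
  have hr : piP p / 2 ∈ Set.Icc (-(piP p / 2)) (piP p / 2) := ⟨by linarith, le_rfl⟩
  have hl : -(piP p / 2) ∈ Set.Icc (-(piP p / 2)) (piP p / 2) := ⟨le_rfl, by linarith⟩
  constructor
  · have := strictMonoOn_sinP hp hl hy' hy.1
    rwa [sinP_neg hp hr, sinP_piP_half hp] at this
  · have := strictMonoOn_sinP hp hy' hr hy.2
    rwa [sinP_piP_half hp] at this

lemma hasDerivAt_sinP (hp : 1 < p) {y : ℝ} (hy : y ∈ Set.Ioo (-(piP p / 2)) (piP p / 2)) :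
    HasDerivAt (sinP p) ((1 - |sinP p y| ^ p) ^ (1 / p)) y := by
  have hs := sinP_mem_Ioo hp hy
  have h1 := Real.rpow_pos_of_pos (one_sub_abs_rpow_pos hp (abs_lt.2 hs)) (1 / p)
  have hd := hasDerivAt_arcsinP hp hs
  have hnhds : Set.Icc (-(piP p / 2)) (piP p / 2) ∈ nhds y := Icc_mem_nhds hy.1 hy.2
  have hc : ContinuousAt (sinP p) y := (continuousOn_sinP hp).continuousAt hnhds
  have := HasDerivAt.of_local_left_inverse hc hd (by positivity)
    (by filter_upwards [hnhds] with z hz using arcsinP_sinP hp hz)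
  simpa using this

lemma cosP_eq (hp : 1 < p) {y : ℝ} (hy : y ∈ Set.Ioo (-(piP p / 2)) (piP p / 2)) :
    cosP p y = (1 - |sinP p y| ^ p) ^ (1 / p) :=
  (hasDerivAt_sinP hp hy).deriv

lemma cosP_pos (hp : 1 < p) {y : ℝ} (hy : y ∈ Set.Ioo (-(piP p / 2)) (piP p / 2)) :
    0 < cosP p y := by
  rw [cosP_eq hp hy]
  exact Real.rpow_pos_of_pos (one_sub_abs_rpow_pos hp (abs_lt.2 (sinP_mem_Ioo hp hy))) (1 / p)

lemma cosP_rpow (hp : 1 < p) {y : ℝ} (hy : y ∈ Set.Ioo (-(piP p / 2)) (piP p / 2)) :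
    cosP p y ^ p = 1 - |sinP p y| ^ p := by
  rw [cosP_eq hp hy, ← Real.rpow_mul
    (one_sub_abs_rpow_pos hp (abs_lt.2 (sinP_mem_Ioo hp hy))).le,
    one_div_mul_cancel (by linarith), Real.rpow_one]

lemma cosP_neg (hp : 1 < p) {y : ℝ} (hy : y ∈ Set.Ioo (-(piP p / 2)) (piP p / 2)) :
    cosP p (-y) = cosP p y := by
  have hy' : -y ∈ Set.Ioo (-(piP p / 2)) (piP p / 2) := ⟨by linarith [hy.2], by linarith [hy.1]⟩
  rw [cosP_eq hp hy, cosP_eq hp hy', sinP_neg hp (Set.Ioo_subset_Icc_self hy), abs_neg]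

lemma sinP_pos (hp : 1 < p) {y : ℝ} (hy0 : 0 < y) (hy : y ≤ piP p / 2) : 0 < sinP p y := by
  have := strictMonoOn_sinP hp (a := 0) ⟨by linarith, by linarith⟩ ⟨by linarith, hy⟩ hy0
  rwa [sinP_zero hp] at this

lemma cosP_signed_rpow (hp : 1 < p) {y : ℝ} (hy : y ∈ Set.Ioo (-(piP p / 2)) (piP p / 2)) :
    |cosP p y| ^ (p - 2) * cosP p y = cosP p y ^ (p - 1) := by
  have h := cosP_pos hp hy
  rw [abs_of_pos h]
  nth_rewrite 2 [← Real.rpow_one (cosP p y)]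
  rw [← Real.rpow_add h]
  congr 1; ring

end Trig

/-! ### The nonlinearity of the phase equation -/

section Phase

variable {p : ℝ}

/-- `y` clamped to `[0, π_p/2]`. -/
noncomputable def clampP (p y : ℝ) : ℝ := max 0 (min y (piP p / 2))

/-- `cos_p^{p-1} sin_p` on `[0, π_p/2]`, extended by `0`. -/
noncomputable def phaseF (p y : ℝ) : ℝ :=
  (1 - sinP p (clampP p y) ^ p) ^ ((p - 1) / p) * sinP p (clampP p y)

lemma clampP_mem (hp : 1 < p) (y : ℝ) : clampP p y ∈ Set.Icc 0 (piP p / 2) := by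
  have := one_le_piP_half hp
  exact ⟨le_max_left _ _, max_le (by linarith) (min_le_right _ _)⟩

lemma clampP_of_mem {y : ℝ} (hy : y ∈ Set.Icc 0 (piP p / 2)) : clampP p y = y := by
  rw [clampP, min_eq_left hy.2, max_eq_right hy.1]

lemma sinP_mem_unit (hp : 1 < p) {y : ℝ} (hy : y ∈ Set.Icc 0 (piP p / 2)) :
    sinP p y ∈ Set.Icc (0 : ℝ) 1 := by
  have h1 := one_le_piP_half hp
  refine ⟨?_, (sinP_mem hp ⟨by linarith [hy.1], hy.2⟩).2⟩
  rcases hy.1.eq_or_lt with h | h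
  · rw [← h, sinP_zero hp]
  · exact (sinP_pos hp h hy.2).le

lemma phaseF_of_mem {y : ℝ} (hy : y ∈ Set.Icc 0 (piP p / 2)) :
    phaseF p y = (1 - sinP p y ^ p) ^ ((p - 1) / p) * sinP p y := by
  rw [phaseF, clampP_of_mem hy]

lemma phaseF_eq (hp : 1 < p) {y : ℝ} (hy : y ∈ Set.Ico 0 (piP p / 2)) :
    phaseF p y = cosP p y ^ (p - 1) * sinP p y := by
  have h1 := one_le_piP_half hp
  have hy' : y ∈ Set.Ioo (-(piP p / 2)) (piP p / 2) := ⟨by linarith [hy.1], hy.2⟩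
  have hs := sinP_mem_unit hp (Set.Ico_subset_Icc_self hy)
  have h2 := one_sub_abs_rpow_pos hp (abs_lt.2 (sinP_mem_Ioo hp hy'))
  rw [phaseF_of_mem (Set.Ico_subset_Icc_self hy), cosP_eq hp hy', ← Real.rpow_mul h2.le,
    abs_of_nonneg hs.1]
  congr 2; ring

lemma phaseF_nonneg (hp : 1 < p) (y : ℝ) : 0 ≤ phaseF p y := by
  have hs := sinP_mem_unit hp (clampP_mem hp y)
  have : sinP p (clampP p y) ^ p ≤ 1 := Real.rpow_le_one hs.1 hs.2 (by linarith)
  exact mul_nonneg (Real.rpow_nonneg (by linarith) _) hs.1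

lemma phaseF_le_one (hp : 1 < p) (y : ℝ) : phaseF p y ≤ 1 := by
  have hs := sinP_mem_unit hp (clampP_mem hp y)
  have h0 : 0 ≤ sinP p (clampP p y) ^ p := Real.rpow_nonneg hs.1 _
  have : sinP p (clampP p y) ^ p ≤ 1 := Real.rpow_le_one hs.1 hs.2 (by linarith)
  refine mul_le_one₀ ?_ hs.1 hs.2
  exact Real.rpow_le_one (by linarith) (by linarith) (div_nonneg (by linarith) (by linarith))

lemma phaseF_of_nonpos (hp : 1 < p) {y : ℝ} (hy : y ≤ 0) : phaseF p y = 0 := by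
  have : clampP p y = 0 := max_eq_left ((min_le_left _ _).trans hy)
  rw [phaseF, this, sinP_zero hp, mul_zero]

lemma phaseF_of_le (hp : 1 < p) {y : ℝ} (hy : piP p / 2 ≤ y) : phaseF p y = 0 := by
  have h1 := one_le_piP_half hp
  have : clampP p y = piP p / 2 := by
    rw [clampP, min_eq_right hy, max_eq_right (by linarith)]
  rw [phaseF, this, sinP_piP_half hp, Real.one_rpow, sub_self, Real.zero_rpow, zero_mul]
  exact (div_pos (by linarith) (by linarith)).ne'

lemma continuousOn_phaseF_Icc (hp : 1 < p) : ContinuousOn (phaseF p) (Set.Icc 0 (piP p / 2)) := by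
  have h1 := one_le_piP_half hp
  have hc : ContinuousOn (sinP p) (Set.Icc 0 (piP p / 2)) :=
    (continuousOn_sinP hp).mono (Set.Icc_subset_Icc_left (by linarith))
  have : ContinuousOn (fun y => (1 - sinP p y ^ p) ^ ((p - 1) / p) * sinP p y)
      (Set.Icc 0 (piP p / 2)) := by
    refine ContinuousOn.mul ?_ hc
    refine ContinuousOn.rpow_const (continuousOn_const.sub ?_) fun _ _ => Or.inr ?_
    · exact hc.rpow_const fun _ _ => Or.inr (by linarith)
    · exact (div_pos (by linarith) (by linarith)).le
  exact this.congr fun y hy => phaseF_of_mem hy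

lemma hasDerivAt_cosP_rpow (hp : 1 < p) {y : ℝ} (hy : y ∈ Set.Ioo 0 (piP p / 2)) :
    HasDerivAt (fun y => cosP p y ^ (p - 1)) (-(p - 1) * sinP p y ^ (p - 1)) y := by
  have hy' : y ∈ Set.Ioo (-(piP p / 2)) (piP p / 2) := ⟨by linarith [hy.1, hy.2], hy.2⟩
  have hs := sinP_pos hp hy.1 hy.2.le
  have h2 := one_sub_abs_rpow_pos hp (abs_lt.2 (sinP_mem_Ioo hp hy'))
  have hd := hasDerivAt_sinP hp hy'
  rw [← cosP_eq hp hy'] at hd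
  have hc := cosP_pos hp hy'
  rw [abs_of_pos hs] at h2
  have h3 := ((hd.rpow_const (p := p) (Or.inl hs.ne')).const_sub 1).rpow_const
    (p := (p - 1) / p) (Or.inl h2.ne')
  have heq : (fun y => cosP p y ^ (p - 1)) =ᶠ[nhds y]
      fun y => (1 - sinP p y ^ p) ^ ((p - 1) / p) := by
    filter_upwards [Ioo_mem_nhds hy.1 hy.2] with z hz
    have hz' : z ∈ Set.Ioo (-(piP p / 2)) (piP p / 2) := ⟨by linarith [hz.1, hz.2], hz.2⟩
    have h4 := one_sub_abs_rpow_pos hp (abs_lt.2 (sinP_mem_Ioo hp hz'))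
    rw [cosP_eq hp hz', ← Real.rpow_mul h4.le, abs_of_pos (sinP_pos hp hz.1 hz.2.le)]
    congr 1; ring
  refine (h3.congr_of_eventuallyEq heq).congr_deriv ?_
  have h5 : 1 - sinP p y ^ p = cosP p y ^ p := by
    rw [cosP_rpow hp hy', abs_of_pos hs]
  rw [h5, ← Real.rpow_mul hc.le]
  have h6 : p * ((p - 1) / p - 1) = -1 := by field_simp; ring
  rw [h6, Real.rpow_neg_one]
  field_simp

/-- Follows from `cos_p^p + sin_p^p = 1`. The derivative is bounded for every `p > 1`, even where `z
↦ z ^ (p - 1)` is singular at `0`, hence the Lipschitz bound; it is negative near `π_p/2`, hence the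
monotonicity used for leastness. -/
lemma hasDerivAt_phaseF (hp : 1 < p) {y : ℝ} (hy : y ∈ Set.Ioo 0 (piP p / 2)) :
    HasDerivAt (phaseF p) (1 - p * sinP p y ^ p) y := by
  have hy' : y ∈ Set.Ioo (-(piP p / 2)) (piP p / 2) := ⟨by linarith [hy.1, hy.2], hy.2⟩
  have hs := sinP_pos hp hy.1 hy.2.le
  have hd := hasDerivAt_sinP hp hy'
  rw [← cosP_eq hp hy'] at hd
  have hc := cosP_pos hp hy'
  have h := (hasDerivAt_cosP_rpow hp hy).mul hd
  have heq : phaseF p =ᶠ[nhds y] fun y => cosP p y ^ (p - 1) * sinP p y := by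
    filter_upwards [Ioo_mem_nhds hy.1 hy.2] with z hz
    exact phaseF_eq hp ⟨hz.1.le, hz.2⟩
  refine (h.congr_of_eventuallyEq heq).congr_deriv ?_
  have h1 : cosP p y ^ (p - 1) * cosP p y = 1 - sinP p y ^ p := by
    rw [Real.rpow_sub_one hc.ne', div_mul_cancel₀ _ hc.ne', cosP_rpow hp hy', abs_of_pos hs]
  have h2 : sinP p y ^ (p - 1) * sinP p y = sinP p y ^ p := by
    rw [Real.rpow_sub_one hs.ne', div_mul_cancel₀ _ hs.ne']
  rw [h1, mul_assoc, h2]; ring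

lemma abs_phaseF_sub_le (hp : 1 < p) {x y : ℝ} (hx : x ∈ Set.Icc 0 (piP p / 2))
    (hy : y ∈ Set.Icc 0 (piP p / 2)) (hxy : x < y) :
    |phaseF p y - phaseF p x| ≤ p * |y - x| := by
  obtain ⟨z, hz, h⟩ := exists_hasDerivAt_eq_slope (phaseF p) (fun y => 1 - p * sinP p y ^ p) hxy
    ((continuousOn_phaseF_Icc hp).mono (Set.Icc_subset_Icc hx.1 hy.2))
    (fun z hz => hasDerivAt_phaseF hp ⟨hx.1.trans_lt hz.1, hz.2.trans_le hy.2⟩)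
  rw [eq_div_iff (by linarith)] at h
  rw [← h, abs_mul]
  refine mul_le_mul_of_nonneg_right ?_ (abs_nonneg _)
  have hs := sinP_mem_unit hp (y := z) ⟨hx.1.trans hz.1.le, hz.2.le.trans hy.2⟩
  have h0 : 0 ≤ sinP p z ^ p := Real.rpow_nonneg hs.1 _
  have h1 : sinP p z ^ p ≤ 1 := Real.rpow_le_one hs.1 hs.2 (by linarith)
  rw [abs_le]
  constructor <;> nlinarith

lemma lipschitzWith_phaseF (hp : 1 < p) : LipschitzWith (Real.toNNReal p) (phaseF p) := by
  have h1 : LipschitzOnWith (Real.toNNReal p) (phaseF p) (Set.Icc 0 (piP p / 2)) := by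
    refine LipschitzOnWith.of_dist_le_mul fun x hx y hy => ?_
    rw [Real.coe_toNNReal p (by linarith), Real.dist_eq, Real.dist_eq]
    rcases lt_trichotomy x y with h | h | h
    · rw [abs_sub_comm, abs_sub_comm x y]; exact abs_phaseF_sub_le hp hx hy h
    · simp [h]
    · exact abs_phaseF_sub_le hp hy hx h
  have h2 : LipschitzWith 1 (clampP p) :=
    (LipschitzWith.id.min_const (piP p / 2)).const_max 0
  have h3 : phaseF p = phaseF p ∘ clampP p := by
    funext y
    simp only [Function.comp, phaseF, clampP_of_mem (clampP_mem hp y)]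
  rw [h3]
  refine LipschitzWith.of_dist_le_mul fun x y => ?_
  refine (h1.dist_le_mul _ (clampP_mem hp x) _ (clampP_mem hp y)).trans ?_
  refine mul_le_mul_of_nonneg_left ?_ (by positivity)
  simpa using h2.dist_le_mul x y

lemma exists_antitoneOn_phaseF (hp : 1 < p) :
    ∃ y₀ ∈ Set.Ico 0 (piP p / 2), AntitoneOn (phaseF p) (Set.Icc y₀ (piP p / 2)) := by
  have hpos : 0 < p := by linarith
  have hs0 : 0 < (1 / p) ^ (1 / p) := Real.rpow_pos_of_pos (by positivity) _
  have hs1 : (1 / p) ^ (1 / p) < 1 :=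
    Real.rpow_lt_one (by positivity) (by rw [div_lt_one hpos]; exact hp) (by positivity)
  -- The value of `sin_p` at which `1 - p sin_p^p` changes sign.
  set s := (1 / p) ^ (1 / p) with hs
  have hsm : s ∈ Set.Icc (-1 : ℝ) 1 := ⟨by linarith, hs1.le⟩
  have hmono := strictMonoOn_arcsinP hp
  have hl : 0 < arcsinP p s := by
    have := hmono (a := 0) (by constructor <;> norm_num) hsm hs0
    rwa [arcsinP_zero] at this
  have hr : arcsinP p s < piP p / 2 := by
    have := hmono hsm (b := 1) (by constructor <;> norm_num) hs1
    rwa [arcsinP_one hp] at this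
  refine ⟨arcsinP p s, ⟨hl.le, hr⟩, ?_⟩
  refine antitoneOn_of_deriv_nonpos (convex_Icc _ _)
    ((continuousOn_phaseF_Icc hp).mono (Set.Icc_subset_Icc_left hl.le)) ?_ ?_
  · intro y hy
    rw [interior_Icc] at hy
    exact (hasDerivAt_phaseF hp ⟨hl.trans hy.1, hy.2⟩).differentiableAt.differentiableWithinAt
  · intro y hy
    rw [interior_Icc] at hy
    rw [(hasDerivAt_phaseF hp ⟨hl.trans hy.1, hy.2⟩).deriv]
    have h1 := one_le_piP_half hp
    have h2 : s ≤ sinP p y := by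
      have := strictMonoOn_sinP hp (arcsinP_mem hp hsm) ⟨by linarith [hy.1], hy.2.le⟩ hy.1
      rw [sinP_arcsinP hp hsm] at this
      exact this.le
    have h3 : s ^ p = 1 / p := by
      rw [hs, ← Real.rpow_mul (by positivity), one_div_mul_cancel hpos.ne', Real.rpow_one]
    have h4 : s ^ p ≤ sinP p y ^ p := Real.rpow_le_rpow hs0.le h2 hpos.le
    rw [h3, div_le_iff₀ hpos] at h4
    linarith

end Phase

/-! ### A scalar phase equation on a half-open interval -/

section PhaseODE

open Set

variable {F c : ℝ → ℝ} {a b P M : ℝ} {L : NNReal}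

/-- `φ` solves `φ' = α + c F(φ)` on `[a, b)` with `φ a = 0`. -/
structure IsPhase (F c : ℝ → ℝ) (a b α : ℝ) (φ : ℝ → ℝ) : Prop where
  init : φ a = 0
  deriv : ∀ x ∈ Ico a b, HasDerivWithinAt φ (α + c x * F (φ x)) (Ico a b) x

namespace IsPhase

variable {α : ℝ} {φ : ℝ → ℝ}

lemma deriv_Ici (h : IsPhase F c a b α φ) {x : ℝ} (hx : x ∈ Ico a b) :
    HasDerivWithinAt φ (α + c x * F (φ x)) (Ici x) x := by
  refine ((h.deriv x hx).mono (s := Ico x b) (Ico_subset_Ico_left hx.1)).mono_of_mem_nhdsWithin ?_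
  exact Ico_mem_nhdsGE hx.2

lemma deriv_Ioo (h : IsPhase F c a b α φ) {x : ℝ} (hx : x ∈ Ioo a b) :
    HasDerivAt φ (α + c x * F (φ x)) x :=
  (h.deriv x ⟨hx.1.le, hx.2⟩).hasDerivAt (Ico_mem_nhds hx.1 hx.2)

lemma continuousOn (h : IsPhase F c a b α φ) : ContinuousOn φ (Ico a b) :=
  fun x hx => (h.deriv x hx).continuousWithinAt

lemma continuousOn_Icc (h : IsPhase F c a b α φ) {s t : ℝ} (hs : a ≤ s) (ht : t < b) :
    ContinuousOn φ (Icc s t) :=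
  h.continuousOn.mono fun _ hx => ⟨hs.trans hx.1, hx.2.trans_lt ht⟩

lemma mono (h : IsPhase F c a b α φ) {b' : ℝ} (hb : b' ≤ b) : IsPhase F c a b' α φ :=
  ⟨h.init, fun x hx => (h.deriv x ⟨hx.1, hx.2.trans_le hb⟩).mono (Ico_subset_Ico_right hb)⟩

/-- Two phases on `[a, t]` stay close when the parameters are close. -/
lemma dist_le {C : ℝ} {β : ℝ} {ψ : ℝ → ℝ} {t : ℝ} (hF : LipschitzWith L F)
    (hC : ∀ x ∈ Ico a t, |c x| ≤ C) (hC0 : 0 ≤ C) (hat : a ≤ t)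
    (h : IsPhase F c a t α φ) (h' : IsPhase F c a t β ψ)
    (hφ : ContinuousOn φ (Icc a t)) (hψ : ContinuousOn ψ (Icc a t)) :
    |φ t - ψ t| ≤ gronwallBound 0 (C * L) |α - β| (t - a) := by
  have key := dist_le_of_approx_trajectories_ODE_of_mem (v := fun x y => β + c x * F y)
    (s := fun _ => univ) (K := C.toNNReal * L) (εf := |α - β|) (εg := 0) (δ := 0)
    (f := φ) (g := ψ) (f' := fun x => α + c x * F (φ x)) (g' := fun x => β + c x * F (ψ x))
    (a := a) (b := t) ?_ hφ (fun x hx => h.deriv_Ici hx) ?_ (fun _ _ => mem_univ _) hψ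
    (fun x hx => h'.deriv_Ici hx) ?_ (fun _ _ => mem_univ _) ?_ t ⟨hat, le_rfl⟩
  · simpa [Real.dist_eq, Real.coe_toNNReal C hC0] using key
  · intro x hx
    refine LipschitzOnWith.of_dist_le_mul fun y _ z _ => ?_
    have := hF.dist_le_mul y z
    simp only [Real.dist_eq] at this ⊢
    have h2 : β + c x * F y - (β + c x * F z) = c x * (F y - F z) := by ring
    rw [h2, abs_mul]
    have h3 := hC x hx
    calc |c x| * |F y - F z| ≤ C * (L * |y - z|) := by gcongr
      _ = _ := by rw [NNReal.coe_mul, Real.coe_toNNReal C hC0]; ring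
  · intro x _
    simp [Real.dist_eq]
  · intro x _
    simp
  · simp [h.init, h'.init]

lemma eq_of_lt {ψ : ℝ → ℝ} {t x : ℝ} (hF : LipschitzWith L F) (hc : ContinuousOn c (Ico a b))
    (h : IsPhase F c a t α φ) (h' : IsPhase F c a t α ψ) (hx : x ∈ Ico a t) (htb : t ≤ b) :
    φ x = ψ x := by
  obtain ⟨C, hC⟩ := isCompact_Icc.exists_bound_of_continuousOn
    (hc.mono fun y hy => ⟨hy.1, hy.2.trans_lt (hx.2.trans_le htb)⟩ : ContinuousOn c (Icc a x))
  have hC0 : 0 ≤ C := (norm_nonneg _).trans (hC a ⟨le_rfl, hx.1⟩)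
  have := dist_le hF (fun y hy => hC y ⟨hy.1, hy.2.le⟩) hC0 hx.1 (h.mono hx.2.le) (h'.mono hx.2.le)
    (h.continuousOn_Icc le_rfl hx.2) (h'.continuousOn_Icc le_rfl hx.2)
  rw [sub_self, abs_zero, gronwallBound_ε0_δ0] at this
  have := abs_nonpos_iff.1 this
  linarith

end IsPhase

lemma exists_isPhase_lt (hF : LipschitzWith L F) (hF0 : ∀ y, 0 ≤ F y) (hF1 : ∀ y, F y ≤ 1)
    (hc : ContinuousOn c (Ico a b)) (α : ℝ) {t : ℝ} (ht : t ∈ Ico a b) :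
    ∃ φ, IsPhase F c a t α φ := by
  have hct : ContinuousOn c (Icc a t) := hc.mono fun y hy => ⟨hy.1, hy.2.trans_lt ht.2⟩
  obtain ⟨C, hC⟩ := isCompact_Icc.exists_bound_of_continuousOn hct
  have hC0 : 0 ≤ C := (norm_nonneg _).trans (hC a ⟨le_rfl, ht.1⟩)
  have hta : 0 ≤ t - a := by linarith [ht.1]
  have hB0 : 0 ≤ |α| + C := by positivity
  -- As `0 ≤ F ≤ 1`, the speed is at most `|α| + C` everywhere, so a ball of radius `(|α| + C) (t -
  -- a)` lets the solution live on all of `[a, t]`.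
  have hpl : IsPicardLindelof (fun x y => α + c x * F y) (tmin := a) (tmax := t)
      ⟨a, le_rfl, ht.1⟩ 0 ((|α| + C) * (t - a)).toNNReal 0 (|α| + C).toNNReal
      (C.toNNReal * L) := by
    refine ⟨?_, ?_, ?_, ?_⟩
    · intro x hx
      refine LipschitzOnWith.of_dist_le_mul fun y _ z _ => ?_
      have := hF.dist_le_mul y z
      simp only [Real.dist_eq] at this ⊢
      have h2 : α + c x * F y - (α + c x * F z) = c x * (F y - F z) := by ring
      rw [h2, abs_mul]
      have h3 : |c x| ≤ C := hC x hx
      calc |c x| * |F y - F z| ≤ C * (L * |y - z|) := by gcongr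
        _ = _ := by rw [NNReal.coe_mul, Real.coe_toNNReal C hC0]; ring
    · intro y _
      exact continuousOn_const.add (hct.mul continuousOn_const)
    · intro x hx y _
      have h3 : |c x| ≤ C := hC x hx
      calc ‖α + c x * F y‖ ≤ |α| + |c x| * |F y| := by
            rw [Real.norm_eq_abs, ← abs_mul]; exact abs_add_le _ _
        _ ≤ |α| + C * 1 := by
            gcongr
            rw [abs_of_nonneg (hF0 y)]; exact hF1 y
        _ = _ := by rw [Real.coe_toNNReal _ hB0, mul_one]
    · simp only [NNReal.coe_zero, sub_zero, sub_self]
      rw [max_eq_left hta, Real.coe_toNNReal _ hB0, Real.coe_toNNReal _ (by positivity)]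
  obtain ⟨φ, h1, h2⟩ := hpl.exists_eq_forall_mem_Icc_hasDerivWithinAt₀
  exact ⟨φ, h1, fun x hx => (h2 x ⟨hx.1, hx.2.le⟩).mono Ico_subset_Icc_self⟩

/-- `c` may be unbounded near `b`, so the solutions on `[a, t)`, `t < b`, are glued by uniqueness.
-/
lemma exists_isPhase (hF : LipschitzWith L F) (hF0 : ∀ y, 0 ≤ F y) (hF1 : ∀ y, F y ≤ 1)
    (hc : ContinuousOn c (Ico a b)) (hab : a < b) (α : ℝ) : ∃ φ, IsPhase F c a b α φ := by
  choose ψ hψ using fun t : Ico a b => exists_isPhase_lt hF hF0 hF1 hc α t.2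
  have hmid : ∀ x ∈ Ico a b, (x + b) / 2 ∈ Ico a b := fun x hx =>
    ⟨by linarith [hx.1, hx.2], by linarith [hx.2]⟩
  classical
  -- The midpoint of `x` and `b` is a convenient `t` with `x < t < b`.
  let φ : ℝ → ℝ := fun x => if hx : x ∈ Ico a b then ψ ⟨(x + b) / 2, hmid x hx⟩ x else 0
  have hφ : ∀ t : Ico a b, ∀ x ∈ Ico a (t : ℝ), φ x = ψ t x := by
    intro t x hx
    have hx' : x ∈ Ico a b := ⟨hx.1, hx.2.trans t.2.2⟩
    simp only [φ, dif_pos hx']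
    have hxm : x < (x + b) / 2 := by linarith [hx'.2]
    refine IsPhase.eq_of_lt (t := min ((x + b) / 2) t) hF hc
      ((hψ ⟨(x + b) / 2, hmid x hx'⟩).mono (min_le_left _ _)) ((hψ t).mono (min_le_right _ _))
      ⟨hx.1, lt_min hxm hx.2⟩ ((min_le_right _ _).trans t.2.2.le)
  refine ⟨φ, ?_, fun x hx => ?_⟩
  · rw [hφ ⟨(a + b) / 2, hmid a ⟨le_rfl, hab⟩⟩ a ⟨le_rfl, by simp only; linarith⟩]
    exact (hψ _).init
  · set t : Ico a b := ⟨(x + b) / 2, hmid x hx⟩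
    have hxt : x < t := by simp only [t]; linarith [hx.2]
    have h1 := (hψ t).deriv x ⟨hx.1, hxt⟩
    rw [← hφ t x ⟨hx.1, hxt⟩] at h1
    have h2 := h1.congr (hφ t) (hφ t x ⟨hx.1, hxt⟩)
    refine h2.mono_of_mem_nhdsWithin ?_
    have : Iio (t : ℝ) ∩ Ico a b ⊆ Ico a t := fun y hy => ⟨hy.2.1, hy.1⟩
    exact Filter.mem_of_superset
      (Filter.inter_mem (mem_nhdsWithin_of_mem_nhds (Iio_mem_nhds hxt)) self_mem_nhdsWithin) this

/-! ### Barriers for a phase and its dependence on the parameter -/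

namespace IsPhase

variable {α : ℝ} {φ : ℝ → ℝ}

/-- Above `P` the equation is `φ' = α`, so a phase that has reached `P` never returns. The slope `α
/ 2` leaves room for the strict inequality that the barrier argument requires. -/
lemma add_le_of_le (h : IsPhase F c a b α φ) (hα : 0 < α) (hFP : ∀ y, P ≤ y → F y = 0)
    {x y : ℝ} (hx : a ≤ x) (hxP : P ≤ φ x) (hxy : x ≤ y) (hy : y < b) :
    P + α / 2 * (y - x) ≤ φ y := by
  refine image_le_of_deriv_right_lt_deriv_boundary' (f := fun z => P + α / 2 * (z - x))
    (f' := fun _ => α / 2) (B := φ) (B' := fun z => α + c z * F (φ z)) (a := x) (b := y)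
    (by fun_prop) ?_ (by simpa using hxP) (h.continuousOn_Icc hx hy)
    (fun z hz => h.deriv_Ici ⟨hx.trans hz.1, hz.2.trans hy⟩) ?_ ⟨hxy, le_rfl⟩
  · intro z _
    have := (((hasDerivAt_id z).sub_const x).const_mul (α / 2)).const_add P
    simpa using this.hasDerivWithinAt
  · intro z hz hz'
    have : P ≤ φ z := by
      rw [← hz']
      have : 0 ≤ α / 2 * (z - x) := mul_nonneg (by linarith) (by linarith [hz.1])
      linarith
    simp only [hFP _ this]
    linarith

lemma nonneg (h : IsPhase F c a b α φ) (hα : 0 < α) (hF0 : F 0 = 0)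
    {y : ℝ} (hy : y ∈ Ico a b) : 0 ≤ φ y := by
  refine image_le_of_deriv_right_lt_deriv_boundary' (f := fun _ => 0)
    (f' := fun _ => 0) (B := φ) (B' := fun z => α + c z * F (φ z)) (a := a) (b := y)
    (by fun_prop) (fun z _ => hasDerivWithinAt_const _ _ _) h.init.ge
    (h.continuousOn_Icc le_rfl hy.2)
    (fun z hz => h.deriv_Ici ⟨hz.1, hz.2.trans hy.2⟩) ?_ ⟨hy.1, le_rfl⟩
  intro z _ hz'
  rw [← hz', hF0]
  linarith

lemma pos (h : IsPhase F c a b α φ) (hα : 0 < α) (hF0 : F 0 = 0)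
    {y : ℝ} (hy : y ∈ Ioo a b) : 0 < φ y := by
  refine lt_of_le_of_ne (h.nonneg hα hF0 ⟨hy.1.le, hy.2⟩) fun h0 => ?_
  have hmin : IsLocalMin φ y := by
    filter_upwards [Ioo_mem_nhds hy.1 hy.2] with z hz
    rw [← h0]; exact h.nonneg hα hF0 ⟨hz.1.le, hz.2⟩
  have := hmin.hasDerivAt_eq_zero (h.deriv_Ioo hy)
  rw [← h0, hF0] at this
  linarith

/-- Since `F ≥ 0`, an upper bound on `c` suffices; this controls the phase up to a singular
endpoint. The extra `1` gives strictness. -/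
lemma le_add (h : IsPhase F c a b α φ) (hF0 : ∀ y, 0 ≤ F y) (hF1 : ∀ y, F y ≤ 1)
    (hM0 : 0 ≤ M) (hM : ∀ x ∈ Ico a b, c x ≤ M)
    {x y : ℝ} (hx : a ≤ x) (hxy : x ≤ y) (hy : y < b) :
    φ y ≤ φ x + (α + M + 1) * (y - x) := by
  refine image_le_of_deriv_right_lt_deriv_boundary' (B := fun z => φ x + (α + M + 1) * (z - x))
    (B' := fun _ => α + M + 1) (f := φ) (f' := fun z => α + c z * F (φ z)) (a := x) (b := y)
    (h.continuousOn_Icc hx hy) (fun z hz => h.deriv_Ici ⟨hx.trans hz.1, hz.2.trans hy⟩)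
    (by simp) (by fun_prop) ?_ ?_ ⟨hxy, le_rfl⟩
  · intro z _
    have := (((hasDerivAt_id z).sub_const x).const_mul (α + M + 1)).const_add (φ x)
    simpa using this.hasDerivWithinAt
  · intro z hz _
    have h1 := hM z ⟨hx.trans hz.1, hz.2.trans hy⟩
    have h2 : c z * F (φ z) ≤ M * 1 :=
      (mul_le_mul_of_nonneg_right h1 (hF0 _)).trans (mul_le_mul_of_nonneg_left (hF1 _) hM0)
    linarith

/-- Serves to bound the parameters whose phase stays below `P`. -/
lemma sub_mul_le {C : ℝ} (h : IsPhase F c a b α φ) (hF0 : ∀ y, 0 ≤ F y) (hF1 : ∀ y, F y ≤ 1)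
    {y : ℝ} (hC : ∀ x ∈ Icc a y, |c x| ≤ C) (hxy : a ≤ y) (hy : y < b) :
    (α - C - 1) * (y - a) ≤ φ y := by
  refine image_le_of_deriv_right_lt_deriv_boundary' (f := fun z => (α - C - 1) * (z - a))
    (f' := fun _ => α - C - 1) (B := φ) (B' := fun z => α + c z * F (φ z)) (a := a) (b := y)
    (by fun_prop) ?_ (by simp [h.init]) (h.continuousOn_Icc le_rfl hy)
    (fun z hz => h.deriv_Ici ⟨hz.1, hz.2.trans hy⟩) ?_ ⟨hxy, le_rfl⟩
  · intro z _
    have := ((hasDerivAt_id z).sub_const a).const_mul (α - C - 1)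
    simpa using this.hasDerivWithinAt
  · intro z hz _
    have h1 := hC z ⟨hz.1, hz.2.le⟩
    have h2 : |c z * F (φ z)| ≤ C * 1 := by
      rw [abs_mul, abs_of_nonneg (hF0 _)]
      exact mul_le_mul h1 (hF1 _) (hF0 _) ((abs_nonneg _).trans h1)
    have := neg_abs_le (c z * F (φ z))
    linarith

lemma exists_dist_lt {Φ : ℝ → ℝ → ℝ} (hΦ : ∀ α, IsPhase F c a b α (Φ α)) (hF : LipschitzWith L F)
    (hc : ContinuousOn c (Ico a b)) (α : ℝ) {t : ℝ} (ht : t ∈ Ico a b) {ε : ℝ} (hε : 0 < ε) :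
    ∃ δ > 0, ∀ β, |β - α| < δ → |Φ β t - Φ α t| < ε := by
  obtain ⟨C, hC⟩ := isCompact_Icc.exists_bound_of_continuousOn
    (hc.mono fun y hy => ⟨hy.1, hy.2.trans_lt ht.2⟩ : ContinuousOn c (Icc a t))
  have hC0 : 0 ≤ C := (norm_nonneg _).trans (hC a ⟨le_rfl, ht.1⟩)
  have h1 := (gronwallBound_continuous_ε 0 (C * L) (t - a)).tendsto 0
  rw [gronwallBound_ε0_δ0] at h1
  obtain ⟨δ, hδ, h2⟩ := Metric.eventually_nhds_iff.1 (h1.eventually (gt_mem_nhds hε))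
  refine ⟨δ, hδ, fun β hβ => ?_⟩
  refine lt_of_le_of_lt (dist_le hF (fun y hy => hC y ⟨hy.1, hy.2.le⟩) hC0 ht.1
    ((hΦ β).mono ht.2.le) ((hΦ α).mono ht.2.le) ((hΦ β).continuousOn_Icc le_rfl ht.2)
    ((hΦ α).continuousOn_Icc le_rfl ht.2)) (h2 ?_)
  simpa [Real.dist_eq] using hβ

end IsPhase

/-- There is a parameter `α` for which the phase reaches `P` exactly at the end of the interval. -/
theorem exists_phase_reaching (hF : LipschitzWith L F) (hF0 : ∀ y, 0 ≤ F y) (hF1 : ∀ y, F y ≤ 1)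
    (hFz : F 0 = 0) (hP : 0 < P) (hFP : ∀ y, P ≤ y → F y = 0) (hab : a < b)
    (hc : ContinuousOn c (Ico a b)) (hM0 : 0 ≤ M) (hM : ∀ x ∈ Ico a b, c x ≤ M) :
    ∃ α φ, 0 < α ∧ IsPhase F c a b α φ ∧ ContinuousOn φ (Icc a b) ∧ φ b = P ∧
      ∀ x ∈ Ico a b, φ x < P := by
  choose Φ hΦ using fun α => exists_isPhase hF hF0 hF1 hc hab α
  have hΦ0 : ∀ x ∈ Ico a b, Φ 0 x = 0 := fun x hx =>
    IsPhase.eq_of_lt hF hc (hΦ 0) (ψ := fun _ => 0)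
      ⟨rfl, fun y _ => by simpa [hFz] using hasDerivWithinAt_const y (Ico a b) (0 : ℝ)⟩ hx le_rfl
  set Λ : Set ℝ := {α | 0 ≤ α ∧ ∀ x ∈ Ico a b, Φ α x < P} with hΛ
  have h0Λ : (0 : ℝ) ∈ Λ := ⟨le_rfl, fun x hx => by rw [hΦ0 x hx]; exact hP⟩
  have hbdd : BddAbove Λ := by
    set t := (a + b) / 2
    have ht : t ∈ Ico a b := ⟨by simp only [t]; linarith, by simp only [t]; linarith⟩
    have hta : 0 < t - a := by simp only [t]; linarith
    obtain ⟨C, hC⟩ := isCompact_Icc.exists_bound_of_continuousOn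
      (hc.mono fun y hy => ⟨hy.1, hy.2.trans_lt ht.2⟩ : ContinuousOn c (Icc a t))
    refine ⟨P / (t - a) + C + 1, fun α hα => ?_⟩
    have h1 := (hΦ α).sub_mul_le hF0 hF1 hC ht.1 ht.2
    have h2 := hα.2 t ht
    have h3 : α - C - 1 ≤ P / (t - a) := by rw [le_div_iff₀ hta]; linarith
    linarith
  set α := sSup Λ with hαdef
  have hα0 : 0 ≤ α := le_csSup hbdd h0Λ
  -- If the phase reached `P` at `x₀`, it would exceed `P` by a definite amount at a later `x₁`; by
  -- continuity in the parameter so would the phases for `β ∈ Λ` just below `α`.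
  have hαΛ : ∀ x ∈ Ico a b, Φ α x < P := by
    intro x₀ hx₀
    by_contra! h
    have hαpos : 0 < α := by
      refine lt_of_le_of_ne hα0 fun h0 => ?_
      rw [← h0, hΦ0 x₀ hx₀] at h
      linarith
    set x₁ := (x₀ + b) / 2
    have hx₁ : x₀ < x₁ := by simp only [x₁]; linarith [hx₀.2]
    have hx₁b : x₁ < b := by simp only [x₁]; linarith [hx₀.2]
    have h1 := (hΦ α).add_le_of_le hαpos hFP hx₀.1 h hx₁.le hx₁b
    have h2 : 0 < α / 2 * (x₁ - x₀) := mul_pos (by linarith) (by linarith)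
    have hx₁' : x₁ ∈ Ico a b := ⟨hx₀.1.trans hx₁.le, hx₁b⟩
    obtain ⟨δ, hδ, h3⟩ := IsPhase.exists_dist_lt hΦ hF hc α hx₁' h2
    obtain ⟨β, hβ, hβα⟩ := exists_lt_of_lt_csSup ⟨0, h0Λ⟩ (show α - δ < sSup Λ by linarith)
    have hβ' : β ≤ α := le_csSup hbdd hβ
    have h4 := h3 β (by rw [abs_lt]; constructor <;> linarith)
    have h5 := hβ.2 x₁ hx₁'
    linarith [(abs_lt.1 h4).1]
  -- If the phase were below `P - ε` at some `x₀` very close to `b`, the same would hold for a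
  -- slightly larger `β ≤ α + 1`. Its speed is at most `β + M + 1 ≤ α + M + 2`, so it could not
  -- cover the remaining `ε` before `b`, and `β ∈ Λ` would contradict the supremum.
  have hlim : ∀ ε > 0, ∃ t ∈ Ico a b, ∀ x ∈ Ico t b, P - ε ≤ Φ α x := by
    intro ε hε
    by_contra! hcon
    have hden : 0 < α + M + 2 := by linarith
    obtain ⟨x₀, hx₀, h1⟩ := hcon (max a (b - ε / (α + M + 2)))
      ⟨le_max_left _ _, max_lt hab (by have := div_pos hε hden; linarith)⟩
    have hx₀' : x₀ ∈ Ico a b := ⟨(le_max_left _ _).trans hx₀.1, hx₀.2⟩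
    have hbx : (α + M + 2) * (b - x₀) ≤ ε := by
      have := (le_max_right _ _).trans hx₀.1
      have : b - x₀ ≤ ε / (α + M + 2) := by linarith
      rw [le_div_iff₀ hden] at this
      linarith
    obtain ⟨δ, hδ, h3⟩ := IsPhase.exists_dist_lt hΦ hF hc α hx₀' (sub_pos.2 h1)
    set β := α + min (δ / 2) 1 with hβ
    have hβα : α < β := by
      have : 0 < min (δ / 2) 1 := lt_min (by linarith) one_pos
      linarith
    have hβ1 : β ≤ α + 1 := by linarith [min_le_right (δ / 2) 1]
    have hβδ : β ≤ α + δ / 2 := by linarith [min_le_left (δ / 2) 1]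
    have h4 := h3 β (by rw [abs_lt]; constructor <;> linarith)
    have h5 : Φ β x₀ < P - ε := by linarith [(abs_lt.1 h4).2]
    have hβΛ : β ∈ Λ := by
      refine ⟨by linarith, fun x hx => ?_⟩
      rcases le_total x x₀ with hxx | hxx
      · by_contra! h6
        have h7 := (hΦ β).add_le_of_le (by linarith) hFP hx.1 h6 hxx hx₀.2
        have : 0 ≤ β / 2 * (x₀ - x) := mul_nonneg (by linarith) (by linarith)
        linarith
      · have h6 := (hΦ β).le_add hF0 hF1 hM0 hM hx₀'.1 hxx hx.2
        have h7 : (β + M + 1) * (x - x₀) ≤ (α + M + 2) * (b - x₀) := by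
          apply mul_le_mul <;> linarith [hx.2]
        linarith
    have := le_csSup hbdd hβΛ
    linarith
  have hαpos : 0 < α := by
    refine lt_of_le_of_ne hα0 fun h0 => ?_
    obtain ⟨t, ht, h⟩ := hlim (P / 2) (by linarith)
    have := h t ⟨le_rfl, ht.2⟩
    rw [← h0, hΦ0 t ht] at this
    linarith
  classical
  -- The solution is only controlled on `[a, b)`; its limit is put in at `b`.
  set φ : ℝ → ℝ := Function.update (Φ α) b P with hφ
  have hφeq : ∀ x ∈ Ico a b, φ x = Φ α x := fun x hx => Function.update_of_ne hx.2.ne _ _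
  have hφb : φ b = P := Function.update_self _ _ _
  have hph : IsPhase F c a b α φ := by
    refine ⟨by rw [hφeq a ⟨le_rfl, hab⟩, (hΦ α).init], fun x hx => ?_⟩
    have := ((hΦ α).deriv x hx).congr hφeq (hφeq x hx)
    rwa [← hφeq x hx] at this
  refine ⟨α, φ, hαpos, hph, ?_, hφb, fun x hx => by rw [hφeq x hx]; exact hαΛ x hx⟩
  intro x hx
  rcases hx.2.lt_or_eq with h | h
  · have := hph.continuousOn x ⟨hx.1, h⟩
    refine this.mono_of_mem_nhdsWithin ?_
    have : Iio b ∩ Icc a b ⊆ Ico a b := fun y hy => ⟨hy.2.1, hy.1⟩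
    exact Filter.mem_of_superset
      (Filter.inter_mem (mem_nhdsWithin_of_mem_nhds (Iio_mem_nhds h)) self_mem_nhdsWithin) this
  · subst h
    rw [Metric.continuousWithinAt_iff]
    intro ε hε
    obtain ⟨t, ht, h⟩ := hlim (ε / 2) (by linarith)
    refine ⟨x - t, by linarith [ht.2], fun y hy hyx => ?_⟩
    rw [hφb, Real.dist_eq]
    rcases hy.2.lt_or_eq with h' | h'
    · rw [Real.dist_eq, abs_lt] at hyx
      have h1 := h y ⟨by linarith [hyx.1], h'⟩
      have h2 := hαΛ y ⟨hy.1, h'⟩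
      rw [hφeq y ⟨hy.1, h'⟩, abs_lt]
      constructor <;> linarith
    · rw [h', hφb]; simpa using hε

/-- A phase reaching `P` at the end of the interval has the least possible parameter. -/
theorem le_of_phase_reaching (hF : LipschitzWith L F) (hP : 0 < P) (hab : a < b)
    (hM0 : 0 ≤ M) (hM : ∀ x ∈ Ico a b, c x ≤ M)
    {y₀ : ℝ} (hy₀ : y₀ < P) (hanti : AntitoneOn F (Icc y₀ P))
    {α β : ℝ} {φ ψ : ℝ → ℝ} (h : IsPhase F c a b α φ)
    (hφc : ContinuousOn φ (Icc a b)) (hφb : φ b = P) (hφP : ∀ x ∈ Ico a b, φ x < P)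
    (hψc : ContinuousOn ψ (Icc a b)) (hψa : ψ a = 0) (hψb : ψ b = P)
    (hψ : ∀ x ∈ Ico a b, ψ x ∈ Ico 0 P → HasDerivWithinAt ψ (β + c x * F (ψ x)) (Ici x) x)
    (hφ0 : ∀ x ∈ Ico a b, 0 ≤ φ x) :
    α ≤ β := by
  by_contra! hβα
  -- `ψ` may leave `[0, P]`, where nothing is known about its equation. Take `x₁` the first time it
  -- reaches `P` and `x₀` its last zero before that; in between it takes values in `[0, P)`.
  have hcl : IsCompact (Icc a b ∩ ψ ⁻¹' Ici P) :=
    isCompact_Icc.of_isClosed_subset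
      (hψc.preimage_isClosed_of_isClosed isClosed_Icc isClosed_Ici) inter_subset_left
  obtain ⟨x₁, ⟨hx₁, hx₁P⟩, hx₁min⟩ := hcl.exists_isLeast ⟨b, ⟨hab.le, le_rfl⟩, hψb.ge⟩
  have hlt : ∀ x ∈ Ico a x₁, ψ x < P := by
    intro x hx
    by_contra! hcon
    have := hx₁min ⟨⟨hx.1, hx.2.le.trans hx₁.2⟩, hcon⟩
    linarith [hx.2]
  have hax₁ : a < x₁ := by
    refine lt_of_le_of_ne hx₁.1 fun h0 => ?_
    rw [← h0, mem_preimage, hψa] at hx₁P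
    exact absurd hx₁P (not_le.2 hP)
  have hψc₁ : ContinuousOn ψ (Icc a x₁) := hψc.mono (Icc_subset_Icc_right hx₁.2)
  have hcl0 : IsCompact (Icc a x₁ ∩ ψ ⁻¹' {0}) :=
    isCompact_Icc.of_isClosed_subset
      (hψc₁.preimage_isClosed_of_isClosed isClosed_Icc isClosed_singleton) inter_subset_left
  obtain ⟨x₀, ⟨hx₀, hx₀z⟩, hx₀max⟩ := hcl0.exists_isGreatest ⟨a, ⟨le_rfl, hax₁.le⟩, hψa⟩
  have hx₀z' : ψ x₀ = 0 := hx₀z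
  have hx₀₁ : x₀ < x₁ := by
    refine lt_of_le_of_ne hx₀.2 fun h0 => ?_
    rw [mem_preimage, ← h0, hx₀z'] at hx₁P
    exact absurd hx₁P (not_le.2 hP)
  have hnn : ∀ x ∈ Ico x₀ x₁, 0 ≤ ψ x := by
    intro x hx
    by_contra! hcon
    obtain ⟨z, hz, hz0⟩ := intermediate_value_Icc hx.2.le
      (hψc₁.mono (Icc_subset_Icc_left (hx₀.1.trans hx.1))) ⟨hcon.le, hP.le.trans hx₁P⟩
    have h1 := hx₀max ⟨⟨hx₀.1.trans (hx.1.trans hz.1), hz.2⟩, hz0⟩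
    have h2 : z = x := le_antisymm (h1.trans hx.1) hz.1
    rw [h2] at hz0
    linarith
  have hder : ∀ x ∈ Ico x₀ x₁, HasDerivWithinAt ψ (β + c x * F (ψ x)) (Ici x) x := fun x hx =>
    hψ x ⟨hx₀.1.trans hx.1, hx.2.trans_le hx₁.2⟩ ⟨hnn x hx, hlt x ⟨hx₀.1.trans hx.1, hx.2⟩⟩
  have hcmp : ∀ x ∈ Icc x₀ x₁, ψ x ≤ φ x := by
    intro x hx
    refine image_le_of_deriv_right_lt_deriv_boundary' (f := ψ) (B := φ) (a := x₀) (b := x₁)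
      (hψc₁.mono (Icc_subset_Icc_left hx₀.1)) hder ?_
      (hφc.mono (Icc_subset_Icc hx₀.1 hx₁.2))
      (fun z hz => h.deriv_Ici ⟨hx₀.1.trans hz.1, hz.2.trans_le hx₁.2⟩) ?_ hx
    · rw [hx₀z']; exact hφ0 x₀ ⟨hx₀.1, hx₀₁.trans_le hx₁.2⟩
    · intro z _ hz
      rw [hz]; linarith
  rcases hx₁.2.lt_or_eq with hlt₁ | heq
  · have h1 := hcmp x₁ ⟨hx₀₁.le, le_rfl⟩
    have h2 := hφP x₁ ⟨hx₁.1, hlt₁⟩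
    have h3 : P ≤ ψ x₁ := hx₁P
    linarith
  · subst heq
    -- Both functions end at `P`, so `ψ ≤ φ` is no contradiction yet. Near `b` both lie in `[y₀,
    -- P]`, where `F` is nonincreasing, and there the gap `φ - ψ` is shown to grow at rate at least
    -- `κ`.
    set κ := (α - β) / 2 with hκ
    have hκ0 : 0 < κ := by simp only [hκ]; linarith
    have hψev : ∀ᶠ x in nhdsWithin x₁ (Icc a x₁), y₀ < ψ x := by
      have := hψc x₁ ⟨hax₁.le, le_rfl⟩
      exact this.eventually (lt_mem_nhds (by rw [hψb]; exact hy₀))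
    obtain ⟨η, hη, hηs⟩ := Metric.mem_nhdsWithin_iff.1 hψev
    have hML : 0 < M * L + 1 := by positivity
    set x₂ := max (max x₀ (x₁ - η / 2)) (x₁ - 1 / (M * L + 1)) with hx₂
    have h1 : x₀ ≤ x₂ := (le_max_left _ _).trans (le_max_left _ _)
    have h2 : x₁ - η / 2 ≤ x₂ := (le_max_right _ _).trans (le_max_left _ _)
    have h3 : x₁ - 1 / (M * L + 1) ≤ x₂ := le_max_right _ _
    have h4 : x₂ < x₁ := by
      refine max_lt (max_lt hx₀₁ (by linarith)) ?_
      have : 0 < 1 / (M * L + 1) := by positivity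
      linarith
    have key : ψ x₁ + κ * (x₁ - x₂) ≤ φ x₁ := by
      refine image_le_of_deriv_right_lt_deriv_boundary' (f := fun z => ψ z + κ * (z - x₂))
        (f' := fun z => β + c z * F (ψ z) + κ) (B := φ) (B' := fun z => α + c z * F (φ z))
        (a := x₂) (b := x₁) ?_ ?_ ?_
        (hφc.mono (Icc_subset_Icc_left (hx₀.1.trans h1)))
        (fun z hz => h.deriv_Ici ⟨hx₀.1.trans (h1.trans hz.1), hz.2⟩) ?_ ⟨h4.le, le_rfl⟩
      · exact (hψc.mono (Icc_subset_Icc_left (hx₀.1.trans h1))).add (by fun_prop)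
      · intro z hz
        have := (((hasDerivAt_id z).sub_const x₂).const_mul κ).hasDerivWithinAt (s := Ici z)
        exact (hder z ⟨h1.trans hz.1, hz.2⟩).add (by simpa using this)
      · simpa using hcmp x₂ ⟨h1, h4.le⟩
      · intro z hz hz'
        have hψφ : ψ z ≤ φ z := hcmp z ⟨h1.trans hz.1, hz.2.le⟩
        have hza : a ≤ z := hx₀.1.trans (h1.trans hz.1)
        have hy₀ψ : y₀ < ψ z := hηs ⟨by
          rw [Metric.mem_ball, Real.dist_eq, abs_lt]
          constructor <;> linarith [hz.1, hz.2], hza, hz.2.le⟩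
        have hφz := hφP z ⟨hza, hz.2⟩
        have ha := hanti ⟨hy₀ψ.le, hψφ.trans hφz.le⟩ ⟨hy₀ψ.le.trans hψφ, hφz.le⟩ hψφ
        have hl := hF.dist_le_mul (φ z) (ψ z)
        rw [Real.dist_eq, Real.dist_eq, abs_of_nonneg (sub_nonneg.2 hψφ),
          abs_of_nonpos (sub_nonpos.2 ha)] at hl
        have hδ : φ z - ψ z = κ * (z - x₂) := by linarith
        have hMz := hM z ⟨hza, hz.2⟩
        have e1 : M * (F (φ z) - F (ψ z)) ≤ c z * (F (φ z) - F (ψ z)) :=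
          mul_le_mul_of_nonpos_right hMz (sub_nonpos.2 ha)
        have e2 : -(M * (L * (κ * (z - x₂)))) ≤ M * (F (φ z) - F (ψ z)) := by
          rw [← mul_neg, ← hδ]
          exact mul_le_mul_of_nonneg_left (by linarith) hM0
        -- `x₂` was chosen within `1 / (M L + 1)` of `b` so that the term in `F φ - F ψ` consumes
        -- less than `κ` of the gain `α - β = 2 κ`.
        have e3 : M * L * (z - x₂) < 1 := by
          have : z - x₂ < 1 / (M * L + 1) := by linarith [hz.2]
          have h5 : 0 ≤ M * L := by positivity
          calc M * L * (z - x₂) ≤ (M * L + 1) * (z - x₂) := by nlinarith [hz.1]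
            _ < (M * L + 1) * (1 / (M * L + 1)) := by gcongr
            _ = 1 := by field_simp
        have e4 : M * (L * (κ * (z - x₂))) < κ := by
          calc M * (L * (κ * (z - x₂))) = κ * (M * L * (z - x₂)) := by ring
            _ < κ * 1 := by gcongr
            _ = κ := mul_one _
        have : c z * (F (φ z) - F (ψ z)) = c z * F (φ z) - c z * F (ψ z) := by ring
        have : α - β = 2 * κ := by simp only [hκ]; ring
        linarith
    rw [hψb, hφb] at key
    have : 0 < κ * (x₁ - x₂) := mul_pos hκ0 (by linarith)
    linarith

end PhaseODE

/-! ### The model weight -/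

section Model

open Set

variable {p K N D : ℝ}

/-- The generalized sine of curvature `K / (N - 1)`, up to a constant factor. -/
noncomputable def snKN (K N x : ℝ) : ℝ :=
  if 0 < K then Real.sin (√(K / (N - 1)) * x)
  else if K = 0 then x
  else Real.sinh (√(-K / (N - 1)) * x)

lemma mul_lt_pi_of_le_diamBound (hN : 1 < N) (hDK : (D : EReal) ≤ diamBound K N) (hK : 0 < K)
    {x : ℝ} (hx : x < D) : √(K / (N - 1)) * x < Real.pi := by
  have hk : 0 < √(K / (N - 1)) := Real.sqrt_pos.2 (div_pos hK (by linarith))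
  rw [diamBound, if_pos hK, EReal.coe_le_coe_iff, le_div_iff₀ hk] at hDK
  nlinarith

lemma snKN_pos (hN : 1 < N) (hDK : (D : EReal) ≤ diamBound K N) {x : ℝ} (hx : x ∈ Ioo 0 D) :
    0 < snKN K N x := by
  rw [snKN]
  split_ifs with h1 h2
  · have hk : 0 < √(K / (N - 1)) := Real.sqrt_pos.2 (div_pos h1 (by linarith))
    exact Real.sin_pos_of_pos_of_lt_pi (mul_pos hk hx.1)
      (mul_lt_pi_of_le_diamBound hN hDK h1 hx.2)
  · exact hx.1
  · have hK : K < 0 := lt_of_le_of_ne (not_lt.1 h1) h2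
    have hk : 0 < √(-K / (N - 1)) := Real.sqrt_pos.2 (div_pos (by linarith) (by linarith))
    exact Real.sinh_pos_iff.2 (mul_pos hk hx.1)

lemma sqrt_mul_sub_one (hN : 1 < N) (k : ℝ) : √(k * (N - 1)) = (N - 1) * √(k / (N - 1)) := by
  have h : 0 < N - 1 := by linarith
  have : k * (N - 1) = (N - 1) ^ 2 * (k / (N - 1)) := by field_simp
  rw [this, Real.sqrt_mul (by positivity), Real.sqrt_sq h.le]

lemma hasDerivAt_snKN (hN : 1 < N) (hDK : (D : EReal) ≤ diamBound K N) {x : ℝ}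
    (hx : x ∈ Ioo 0 D) :
    HasDerivAt (snKN K N) (cotKN K N x / (N - 1) * snKN K N x) x := by
  have hpos := snKN_pos hN hDK hx
  have hN' : N - 1 ≠ 0 := by linarith
  rcases lt_trichotomy K 0 with hK | hK | hK
  · have h1 : ¬ 0 < K := by linarith
    have h2 : snKN K N = fun x => Real.sinh (√(-K / (N - 1)) * x) := by
      funext x; simp [snKN, h1, hK.ne]
    rw [h2] at hpos ⊢
    have := ((hasDerivAt_id x).const_mul (√(-K / (N - 1)))).sinh
    refine this.congr_deriv ?_
    rw [cotKN, if_neg h1, if_neg hK.ne, sqrt_mul_sub_one hN]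
    simp only [id_eq, mul_one]
    have hne : Real.sinh (√(-K / (N - 1)) * x) ≠ 0 := hpos.ne'
    generalize √(-K / (N - 1)) = k at hne ⊢
    field_simp
  · subst hK
    have h2 : snKN 0 N = fun x => x := by funext x; simp [snKN]
    rw [h2]
    refine (hasDerivAt_id' x).congr_deriv ?_
    have := hx.1.ne'
    simp only [cotKN, lt_irrefl, if_false, if_true]
    field_simp
  · have h2 : snKN K N = fun x => Real.sin (√(K / (N - 1)) * x) := by
      funext x; simp [snKN, hK]
    rw [h2] at hpos ⊢
    have := ((hasDerivAt_id x).const_mul (√(K / (N - 1)))).sin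
    refine this.congr_deriv ?_
    rw [cotKN, if_pos hK, sqrt_mul_sub_one hN, Real.cot_eq_cos_div_sin]
    simp only [id_eq, mul_one]
    have := hpos.ne'
    field_simp

lemma continuousOn_cotKN (hN : 1 < N) (hDK : (D : EReal) ≤ diamBound K N) :
    ContinuousOn (cotKN K N) (Ioo 0 D) := by
  have hpos : ∀ x ∈ Ioo 0 D, snKN K N x ≠ 0 := fun x hx => (snKN_pos hN hDK hx).ne'
  rcases lt_trichotomy K 0 with hK | hK | hK
  · have h1 : ¬ 0 < K := by linarith
    simp only [snKN, h1, hK.ne, if_false] at hpos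
    have h2 : cotKN K N = fun x => √(-K * (N - 1)) *
        (Real.cosh (√(-K / (N - 1)) * x) / Real.sinh (√(-K / (N - 1)) * x)) := by
      funext x; simp only [cotKN, h1, hK.ne, if_false]
    rw [h2]
    exact continuousOn_const.mul (ContinuousOn.div (by fun_prop) (by fun_prop) hpos)
  · subst hK
    have h2 : cotKN 0 N = fun x => (N - 1) / x := by funext x; simp [cotKN]
    rw [h2]
    exact continuousOn_const.div continuousOn_id fun x hx => hx.1.ne'
  · simp only [snKN, hK, if_true] at hpos
    have h2 : cotKN K N = fun x => √(K * (N - 1)) *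
        (Real.cos (√(K / (N - 1)) * x) / Real.sin (√(K / (N - 1)) * x)) := by
      funext x; simp only [cotKN, hK, if_true, Real.cot_eq_cos_div_sin]
    rw [h2]
    exact continuousOn_const.mul (ContinuousOn.div (by fun_prop) (by fun_prop) hpos)

lemma cos_div_sin_le_inv {θ : ℝ} (h0 : 0 < θ) (h1 : θ < Real.pi) :
    Real.cos θ / Real.sin θ ≤ θ⁻¹ := by
  have hs := Real.sin_pos_of_pos_of_lt_pi h0 h1
  rcases lt_or_ge θ (Real.pi / 2) with h | h
  · have ht := Real.lt_tan h0 h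
    have hc := Real.cos_pos_of_mem_Ioo ⟨by linarith, h⟩
    rw [Real.tan_eq_sin_div_cos] at ht
    have := inv_anti₀ h0 ht.le
    rwa [inv_div] at this
  · have hc := Real.cos_nonpos_of_pi_div_two_le_of_le h (by linarith)
    exact (div_nonpos_of_nonpos_of_nonneg hc hs.le).trans (by positivity)

/-- No lower bound holds in general: for `K > 0` and `D = D_{K,N}` the function tends to `-∞` at
`D`. -/
lemma exists_cotKN_le (hN : 1 < N) (hD : 0 < D) (hDK : (D : EReal) ≤ diamBound K N) :
    ∃ M, 0 ≤ M ∧ ∀ x ∈ Ico (D / 2) D, cotKN K N x ≤ M := by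
  have hN' : 0 < N - 1 := by linarith
  rcases lt_trichotomy K 0 with hK | hK | hK
  · have h1 : ¬ 0 < K := by linarith
    -- For `K < 0` there is no diameter bound, so continuity on `(0, 2D)` covers the compact `[D/2,
    -- D]`.
    have hc := continuousOn_cotKN (D := 2 * D) (K := K) hN (by simp [diamBound, h1])
    obtain ⟨C, hC⟩ := isCompact_Icc.exists_bound_of_continuousOn
      (hc.mono fun y hy => ⟨by linarith [hy.1], by linarith [hy.2]⟩ :
        ContinuousOn (cotKN K N) (Icc (D / 2) D))
    exact ⟨C, (norm_nonneg _).trans (hC D ⟨by linarith, le_rfl⟩),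
      fun x hx => (le_abs_self _).trans (hC x ⟨hx.1, hx.2.le⟩)⟩
  · subst hK
    refine ⟨(N - 1) / (D / 2), by positivity, fun x hx => ?_⟩
    simp only [cotKN, lt_irrefl, if_false, if_true]
    gcongr
    exact hx.1
  · have hk : 0 < √(K / (N - 1)) := Real.sqrt_pos.2 (div_pos hK hN')
    refine ⟨√(K * (N - 1)) * (√(K / (N - 1)) * (D / 2))⁻¹, by positivity, fun x hx => ?_⟩
    have hx0 : 0 < x := by linarith [hx.1]
    simp only [cotKN, hK, if_true, Real.cot_eq_cos_div_sin]
    refine mul_le_mul_of_nonneg_left ?_ (Real.sqrt_nonneg _)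
    refine (cos_div_sin_le_inv (mul_pos hk hx0) (mul_lt_pi_of_le_diamBound hN hDK hK hx.2)).trans ?_
    gcongr
    exact hx.1

/-! ### The model problem -/

lemma rpow_param (hp : 1 < p) {α : ℝ} (hα : 0 ≤ α) :
    ((p - 1) * α ^ p / (p - 1)) ^ (1 / p) = α := by
  rw [mul_div_cancel_left₀ _ (by linarith : p - 1 ≠ 0), ← Real.rpow_mul hα,
    mul_one_div_cancel (by linarith), Real.rpow_one]

lemma model_rhs_eq (hp : 1 < p) {φ x α : ℝ} (hx : D / 2 ≤ x) (hφ : φ ∈ Ico 0 (piP p / 2)) :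
    α + 1 / (p - 1) * modelT K N D x * (|cosP p φ| ^ (p - 2) * cosP p φ) * sinP p φ
      = α + cotKN K N x / (p - 1) * phaseF p φ := by
  have h1 := one_le_piP_half hp
  rw [modelT, if_neg (not_lt.2 hx), cosP_signed_rpow hp ⟨by linarith [hφ.1], hφ.2⟩,
    phaseF_eq hp hφ]
  ring

lemma model_rhs_eq_neg (hp : 1 < p) {φ x α : ℝ} (hx : x < D / 2) (hφ : φ ∈ Ico 0 (piP p / 2)) :
    α + 1 / (p - 1) * modelT K N D x * (|cosP p (-φ)| ^ (p - 2) * cosP p (-φ)) * sinP p (-φ)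
      = α + cotKN K N (D - x) / (p - 1) * phaseF p φ := by
  have h1 := one_le_piP_half hp
  have hφ' : φ ∈ Ioo (-(piP p / 2)) (piP p / 2) := ⟨by linarith [hφ.1], hφ.2⟩
  rw [modelT, if_pos hx, cosP_neg hp hφ', sinP_neg hp (Ioo_subset_Icc_self hφ'),
    cosP_signed_rpow hp hφ', phaseF_eq hp hφ]
  ring

lemma mem_modelParameters (hp : 1 < p) (hD : 0 < D) {α : ℝ} {φ : ℝ → ℝ} (hα : 0 < α)
    (h : IsPhase (phaseF p) (fun x => cotKN K N x / (p - 1)) (D / 2) D α φ)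
    (hφc : ContinuousOn φ (Icc (D / 2) D)) (hφD : φ D = piP p / 2)
    (hφP : ∀ x ∈ Ico (D / 2) D, φ x < piP p / 2) :
    (p - 1) * α ^ p ∈ modelParameters p K N D := by
  refine ⟨mul_nonneg (by linarith) (Real.rpow_nonneg hα.le _), ?_⟩
  have hP := one_le_piP_half hp
  have hF0 : phaseF p 0 = 0 := phaseF_of_nonpos hp le_rfl
  have hmem : ∀ x ∈ Ico (D / 2) D, φ x ∈ Ico 0 (piP p / 2) := fun x hx =>
    ⟨h.nonneg hα hF0 hx, hφP x hx⟩
  have hinit : φ (D / 2) = 0 := h.init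
  have hhalf : D - D / 2 = D / 2 := by ring
  set ψ : ℝ → ℝ := fun x => if x < D / 2 then -φ (D - x) else φ x with hψ
  have hright : ∀ x, D / 2 ≤ x → ψ x = φ x := fun x hx => if_neg (not_lt.2 hx)
  have hleft : ∀ x, x ≤ D / 2 → ψ x = -φ (D - x) := by
    intro x hx
    rcases hx.lt_or_eq with h' | h'
    · exact if_pos h'
    · rw [h', hright _ le_rfl, hhalf, hinit, neg_zero]
  have hrefl : ContinuousOn (fun x => -φ (D - x)) (Icc 0 (D / 2)) := by
    refine (hφc.comp (by fun_prop) fun x hx => ?_).neg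
    exact ⟨by linarith [hx.2], by linarith [hx.1]⟩
  refine ⟨ψ, ⟨?_, ?_, ?_, ?_, ?_⟩⟩
  · have h1 : ContinuousOn ψ (Icc 0 (D / 2)) := hrefl.congr fun x hx => hleft x hx.2
    have h2 : ContinuousOn ψ (Icc (D / 2) D) := hφc.congr fun x hx => hright x hx.1
    have := h1.union_of_isClosed h2 isClosed_Icc isClosed_Icc
    rwa [Icc_union_Icc_eq_Icc (by linarith) (by linarith)] at this
  · intro x hx
    rw [rpow_param hp hα.le]
    have hreflder : ∀ y ∈ Ioo 0 (D / 2), HasDerivAt (fun x => -φ (D - x))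
        (α + cotKN K N (D - y) / (p - 1) * phaseF p (φ (D - y))) y := by
      intro y hy
      have h1 := h.deriv_Ioo (x := D - y) ⟨by linarith [hy.2], by linarith [hy.1]⟩
      have h2 := (h1.comp y ((hasDerivAt_id y).const_sub D)).neg
      simpa [Function.comp_def] using! h2
    rcases lt_trichotomy x (D / 2) with hlt | heq | hgt
    · have hev : ψ =ᶠ[nhds x] fun x => -φ (D - x) := by
        filter_upwards [Iio_mem_nhds hlt] with y hy using hleft y (le_of_lt hy)
      refine ((hreflder x ⟨hx.1, hlt⟩).congr_of_eventuallyEq hev).congr_deriv ?_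
      rw [hleft x hlt.le]
      exact (model_rhs_eq_neg hp hlt (hmem (D - x) ⟨by linarith, by linarith [hx.1]⟩)).symm
    -- The jump of `modelT` at the midpoint is harmless because it is multiplied by `sin_p 0 = 0`:
    -- both one-sided derivatives equal `α`.
    · subst heq
      have h1 : HasDerivWithinAt ψ α (Ici (D / 2)) (D / 2) := by
        have := h.deriv_Ici (x := D / 2) ⟨le_rfl, by linarith⟩
        rw [hinit, hF0, mul_zero, add_zero] at this
        exact this.congr (fun y hy => hright y hy) (hright _ le_rfl)
      have h2 : HasDerivWithinAt ψ α (Iic (D / 2)) (D / 2) := by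
        have h3 : HasDerivWithinAt φ α (Ici (D / 2)) (D - D / 2) := by
          have := h.deriv_Ici (x := D / 2) ⟨le_rfl, by linarith⟩
          rw [hinit, hF0, mul_zero, add_zero] at this
          rwa [hhalf]
        have h4 : HasDerivWithinAt (fun y => D - y) (-1) (Iic (D / 2)) (D / 2) :=
          ((hasDerivAt_id (D / 2)).const_sub D).hasDerivWithinAt
        have h5 := (h3.comp (D / 2) h4 fun y hy => by
          simp only [mem_Iic, mem_Ici] at hy ⊢; linarith).neg
        have h6 : HasDerivWithinAt (fun x => -φ (D - x)) α (Iic (D / 2)) (D / 2) := by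
          simpa [Function.comp_def] using! h5
        exact h6.congr (fun y hy => hleft y hy) (hleft _ le_rfl)
      have h3 := h2.union h1
      rw [Iic_union_Ici, hasDerivWithinAt_univ] at h3
      refine h3.congr_deriv ?_
      rw [hright _ le_rfl, hinit, sinP_zero hp, mul_zero, add_zero]
    · have hev : ψ =ᶠ[nhds x] φ := by
        filter_upwards [Ioi_mem_nhds hgt] with y hy using hright y (le_of_lt hy)
      refine ((h.deriv_Ioo ⟨hgt, hx.2⟩).congr_of_eventuallyEq hev).congr_deriv ?_
      rw [hright x hgt.le]
      exact (model_rhs_eq hp hgt.le (hmem x ⟨hgt.le, hx.2⟩)).symm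
  · rw [hleft 0 (by linarith), sub_zero, hφD]
  · rw [hright _ le_rfl, hinit]
  · rw [hright D (by linarith), hφD]

/-- The model problem has a least parameter, realized by a phase on `[D/2, D]`. -/
theorem exists_isLeast_modelParameters (hp : 1 < p) (hN : 1 < N) (hD : 0 < D)
    (hDK : (D : EReal) ≤ diamBound K N) :
    ∃ α φ, 0 < α ∧ IsPhase (phaseF p) (fun x => cotKN K N x / (p - 1)) (D / 2) D α φ ∧
      (∀ x ∈ Ico (D / 2) D, φ x < piP p / 2) ∧
      IsLeast (modelParameters p K N D) ((p - 1) * α ^ p) := by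
  have hP := one_le_piP_half hp
  have hp1 : 0 < p - 1 := by linarith
  have hab : D / 2 < D := by linarith
  have hF0 : phaseF p 0 = 0 := phaseF_of_nonpos hp le_rfl
  obtain ⟨M, hM0, hM⟩ := exists_cotKN_le hN hD hDK
  have hM0' : 0 ≤ M / (p - 1) := by positivity
  have hM' : ∀ x ∈ Ico (D / 2) D, cotKN K N x / (p - 1) ≤ M / (p - 1) := fun x hx =>
    div_le_div_of_nonneg_right (hM x hx) hp1.le
  have hc : ContinuousOn (fun x => cotKN K N x / (p - 1)) (Ico (D / 2) D) :=
    ((continuousOn_cotKN hN hDK).mono fun x hx => ⟨by linarith [hx.1], hx.2⟩).div_const _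
  obtain ⟨α, φ, hα, hφ, hφc, hφD, hφP⟩ := exists_phase_reaching (lipschitzWith_phaseF hp)
    (phaseF_nonneg hp) (phaseF_le_one hp) hF0 (by linarith)
    (fun y hy => phaseF_of_le hp hy) hab hc hM0' hM'
  refine ⟨α, φ, hα, hφ, hφP, mem_modelParameters hp hD hα hφ hφc hφD hφP, ?_⟩
  rintro lam ⟨hlam, ψ, hψ⟩
  obtain ⟨y₀, hy₀, hanti⟩ := exists_antitoneOn_phaseF hp
  have hle := le_of_phase_reaching (lipschitzWith_phaseF hp) (P := piP p / 2) (by linarith) hab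
    hM0' hM' hy₀.2 hanti (β := (lam / (p - 1)) ^ (1 / p)) hφ hφc hφD hφP
    (hψ.continuousOn.mono (Icc_subset_Icc_left (by linarith))) hψ.mid hψ.right
    (fun x hx hx' => by
      have := hψ.ode x ⟨by linarith [hx.1], hx.2⟩
      rw [model_rhs_eq hp hx.1 hx'] at this
      exact this.hasDerivWithinAt) (fun x hx => hφ.nonneg hα hF0 hx)
  have hq : 0 ≤ lam / (p - 1) := by positivity
  have := Real.rpow_le_rpow hα.le hle (by linarith : 0 ≤ p)
  rw [← Real.rpow_mul hq, one_div_mul_cancel (by linarith), Real.rpow_one,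
    le_div_iff₀ hp1] at this
  linarith

end Model

/-! ### A Picone inequality for the model weight -/

section Picone

open Set

variable {p K N D : ℝ}

lemma abs_abs_rpow_sub_two_mul (hp : 1 < p) (z : ℝ) :
    |(|z| ^ (p - 2) * z)| = |z| ^ (p - 1) := by
  rcases eq_or_ne z 0 with rfl | hz
  · simp [Real.zero_rpow (by linarith : p - 1 ≠ 0)]
  · have h := abs_pos.2 hz
    rw [abs_mul, abs_of_nonneg (Real.rpow_nonneg h.le _)]
    nth_rewrite 2 [← Real.rpow_one |z|]
    rw [← Real.rpow_add h]
    congr 1; ring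

/-- The convex function `|·|^p` lies above its tangent at `z`. Used both for Picone's inequality and
for the minimality of the `p`-mean. -/
lemma young_tangent (hp : 1 < p) (z d : ℝ) :
    p * (|z| ^ (p - 2) * z) * d ≤ |d| ^ p + (p - 1) * |z| ^ p := by
  have hp0 : 0 < p := by linarith
  have hp1 : 0 < p - 1 := by linarith
  have h1 := Real.young_inequality_of_nonneg (abs_nonneg d)
    (Real.rpow_nonneg (abs_nonneg z) (p - 1)) (Real.HolderConjugate.conjExponent hp)
  rw [← Real.rpow_mul (abs_nonneg z), Real.conjExponent,
    show (p - 1) * (p / (p - 1)) = p by field_simp] at h1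
  have h2 : (|z| ^ (p - 2) * z) * d ≤ |d| * |z| ^ (p - 1) := by
    rw [← abs_abs_rpow_sub_two_mul hp, mul_comm |d|, ← abs_mul]
    exact le_abs_self _
  calc p * (|z| ^ (p - 2) * z) * d = p * ((|z| ^ (p - 2) * z) * d) := by ring
    _ ≤ p * (|d| ^ p / p + |z| ^ p / (p / (p - 1))) := by gcongr; exact h2.trans h1
    _ = _ := by field_simp

lemma intervalIntegrable_energy {v m : ℝ → ℝ} {C : NNReal} {y t lam : ℝ} (hp : 0 ≤ p)
    (hv : LipschitzWith C v) (hm : ContinuousOn m (uIcc y t)) :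
    IntervalIntegrable (fun x => m x * (|deriv v x| ^ p - lam * |v x| ^ p)) volume y t := by
  have h2 : IntervalIntegrable (fun x => |v x| ^ p) volume y t :=
    ((hv.continuous.abs).rpow_const fun _ => Or.inr hp).intervalIntegrable _ _
  have h1 : IntervalIntegrable (fun x => |deriv v x| ^ p) volume y t := by
    refine (intervalIntegrable_const (c := (C : ℝ) ^ p)).mono_fun'
      (((measurable_deriv v).abs.pow_const p).aestronglyMeasurable) ?_
    refine Filter.Eventually.of_forall fun x => ?_
    simp only
    rw [Real.norm_of_nonneg (by positivity)]
    exact Real.rpow_le_rpow (abs_nonneg _) (norm_deriv_le_of_lipschitz hv) hp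
  exact (h1.sub (h2.const_mul lam)).continuousOn_mul hm

/-- Picone's inequality, with `r` the logarithmic derivative of a positive solution of the
`p`-Laplace equation with weight `m`, and `G = m r^{p-1}`. -/
lemma picone (hp : 1 < p) {m r G v : ℝ → ℝ} {C : NNReal} {y t lam : ℝ} (hyt : y ≤ t)
    (hv : LipschitzWith C v) (hm : ContinuousOn m (Icc y t)) (hm0 : ∀ x ∈ Icc y t, 0 ≤ m x)
    (hr : ContinuousOn r (Icc y t)) (hr0 : ∀ x ∈ Icc y t, 0 < r x)
    (hG : ∀ x ∈ Icc y t, G x = m x * r x ^ (p - 1))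
    (hGd : ∀ x ∈ Icc y t, HasDerivAt G (-(m x * (lam + (p - 1) * r x ^ p))) x) :
    G t * |v t| ^ p - G y * |v y| ^ p
      ≤ ∫ x in y..t, m x * (|deriv v x| ^ p - lam * |v x| ^ p) := by
  have hu : uIcc y t = Icc y t := uIcc_of_le hyt
  have hGac : AbsolutelyContinuousOnInterval G y t := by
    have hcont : ContinuousOn (fun x => -(m x * (lam + (p - 1) * r x ^ p))) (Icc y t) := by
      refine (hm.mul (continuousOn_const.add (continuousOn_const.mul ?_))).neg
      exact hr.rpow_const fun x _ => Or.inr (by linarith)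
    obtain ⟨B, hB⟩ := isCompact_Icc.exists_bound_of_continuousOn hcont
    have := (convex_Icc y t).lipschitzOnWith_of_nnnorm_hasDerivWithin_le (C := B.toNNReal)
      (fun x hx => (hGd x hx).hasDerivWithinAt) fun x hx => by
        rw [← norm_toNNReal]; exact Real.toNNReal_le_toNNReal (hB x hx)
    rw [← hu] at this
    exact this.absolutelyContinuousOnInterval
  have hVac : AbsolutelyContinuousOnInterval (fun x => |v x| ^ p) y t := by
    obtain ⟨B, hB⟩ := isCompact_Icc.exists_bound_of_continuousOn
      (hv.continuous.continuousOn (s := Icc y t))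
    have h1 : ContDiffOn ℝ 1 (fun x : ℝ => ‖x‖ ^ p) (Icc (-B) B) :=
      (contDiff_norm_rpow hp).contDiffOn
    obtain ⟨L, hL⟩ := h1.exists_lipschitzOnWith (by decide) (convex_Icc _ _) isCompact_Icc
    have h2 : LipschitzOnWith (L * C) ((fun x : ℝ => ‖x‖ ^ p) ∘ v) (Icc y t) :=
      hL.comp hv.lipschitzOnWith fun x hx => abs_le.1 (hB x hx)
    rw [← hu] at h2
    exact h2.absolutelyContinuousOnInterval
  have hGV := hGac.fun_mul hVac
  rw [← hGV.integral_deriv_eq_sub]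
  refine intervalIntegral.integral_mono_ae_restrict hyt hGV.intervalIntegrable_deriv
    (intervalIntegrable_energy (by linarith) hv (by rwa [hu])) ?_
  filter_upwards [ae_restrict_mem measurableSet_Icc, ae_restrict_of_ae
    (hv.ae_differentiableAt_real)] with x hx hvx
  have hVd := (hasDerivAt_abs_rpow (v x) hp).comp x hvx.hasDerivAt
  have hd := ((hGd x hx).mul hVd).deriv
  have hd' : deriv (fun x => G x * |v x| ^ p) x = _ := hd
  rw [hd', hG x hx]
  simp only [Function.comp]
  -- The tangent at `r v`: its terms `p r^{p-1} |v|^{p-2} v v'` and `(p - 1) r^p |v|^p` are those of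
  -- `(G |v|^p)'` divided by `m`.
  have hy := young_tangent hp (r x * v x) (deriv v x)
  have hrx := hr0 x hx
  rw [abs_mul, abs_of_pos hrx, Real.mul_rpow hrx.le (abs_nonneg _),
    Real.mul_rpow hrx.le (abs_nonneg _)] at hy
  have e : r x ^ (p - 1) = r x ^ (p - 2) * r x := by
    rw [← Real.rpow_add_one hrx.ne']; congr 1; ring
  rw [e]
  have := mul_le_mul_of_nonneg_left hy (hm0 x hx)
  linarith

/-- The weight of the model space. -/
noncomputable def modelWeight (K N x : ℝ) : ℝ := snKN K N x ^ (N - 1)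

lemma modelWeight_pos (hN : 1 < N) (hDK : (D : EReal) ≤ diamBound K N) {x : ℝ}
    (hx : x ∈ Ioo 0 D) : 0 < modelWeight K N x :=
  Real.rpow_pos_of_pos (snKN_pos hN hDK hx) _

lemma hasDerivAt_modelWeight (hN : 1 < N) (hDK : (D : EReal) ≤ diamBound K N) {x : ℝ}
    (hx : x ∈ Ioo 0 D) :
    HasDerivAt (modelWeight K N) (cotKN K N x * modelWeight K N x) x := by
  have hs := snKN_pos hN hDK hx
  have := (hasDerivAt_snKN hN hDK hx).rpow_const (p := N - 1) (Or.inl hs.ne')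
  refine this.congr_deriv ?_
  rw [modelWeight, Real.rpow_sub_one hs.ne']
  have : N - 1 ≠ 0 := by linarith
  field_simp

lemma continuousOn_modelWeight (hN : 1 < N) (hDK : (D : EReal) ≤ diamBound K N) :
    ContinuousOn (modelWeight K N) (Ioo 0 D) :=
  fun _ hx => (hasDerivAt_modelWeight hN hDK hx).continuousAt.continuousWithinAt

lemma hasDerivAt_cot_rpow (hp : 1 < p) {y : ℝ} (hy : y ∈ Ioo 0 (piP p / 2)) :
    HasDerivAt (fun y => (cosP p y / sinP p y) ^ (p - 1)) (-(p - 1) / sinP p y ^ p) y := by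
  have hy' : y ∈ Ioo (-(piP p / 2)) (piP p / 2) := ⟨by linarith [hy.1, hy.2], hy.2⟩
  have hs := sinP_pos hp hy.1 hy.2.le
  have hc := cosP_pos hp hy'
  have hd := hasDerivAt_sinP hp hy'
  rw [← cosP_eq hp hy'] at hd
  have h1 := (hasDerivAt_cosP_rpow hp hy).div (hd.rpow_const (p := p - 1) (Or.inl hs.ne'))
    (Real.rpow_pos_of_pos hs _).ne'
  have heq : (fun y => (cosP p y / sinP p y) ^ (p - 1)) =ᶠ[nhds y]
      fun y => cosP p y ^ (p - 1) / sinP p y ^ (p - 1) := by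
    filter_upwards [Ioo_mem_nhds hy.1 hy.2] with z hz
    exact Real.div_rpow (cosP_pos hp ⟨by linarith [hz.1, hz.2], hz.2⟩).le
      (sinP_pos hp hz.1 hz.2.le).le _
  refine (h1.congr_of_eventuallyEq heq).congr_deriv ?_
  have e1 := cosP_rpow hp hy'
  rw [abs_of_pos hs] at e1
  have e2 : cosP p y ^ (p - 1) * cosP p y = cosP p y ^ p := by
    rw [Real.rpow_sub_one hc.ne', div_mul_cancel₀ _ hc.ne']
  have e3 : sinP p y ^ p = sinP p y ^ (p - 1) * sinP p y := by
    rw [Real.rpow_sub_one hs.ne', div_mul_cancel₀ _ hs.ne']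
  have e4 : sinP p y ^ (p - 1 - 1) = sinP p y ^ (p - 1) / sinP p y := Real.rpow_sub_one hs.ne' _
  have hS := Real.rpow_pos_of_pos hs (p - 1)
  rw [e4]
  have e5 : cosP p y ^ (p - 1) * (cosP p y * (p - 1) * (sinP p y ^ (p - 1) / sinP p y))
      = (1 - sinP p y ^ p) * (p - 1) * (sinP p y ^ (p - 1) / sinP p y) := by
    rw [← e1, ← e2]; ring
  rw [e5, e3]
  field_simp
  ring

/-- The sharp Dirichlet–Neumann inequality for the model weight, on each `[D/2, t]`. -/
theorem integral_modelWeight_energy_nonneg (hp : 1 < p) (hN : 1 < N) (hD : 0 < D)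
    (hDK : (D : EReal) ≤ diamBound K N) {α : ℝ} {φ : ℝ → ℝ} (hα : 0 < α)
    (h : IsPhase (phaseF p) (fun x => cotKN K N x / (p - 1)) (D / 2) D α φ)
    (hφP : ∀ x ∈ Ico (D / 2) D, φ x < piP p / 2) {v : ℝ → ℝ} {C : NNReal}
    (hv : LipschitzWith C v) (hv0 : v (D / 2) = 0) {t : ℝ} (ht : t ∈ Ioo (D / 2) D) :
    0 ≤ ∫ x in D / 2..t, modelWeight K N x *
      (|deriv v x| ^ p - (p - 1) * α ^ p * |v x| ^ p) := by
  have hP := one_le_piP_half hp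
  have hp1 : 0 < p - 1 := by linarith
  have hF0 : phaseF p 0 = 0 := phaseF_of_nonpos hp le_rfl
  have hmem : ∀ x ∈ Ioo (D / 2) D, φ x ∈ Ioo 0 (piP p / 2) := fun x hx =>
    ⟨h.pos hα hF0 hx, hφP x ⟨hx.1.le, hx.2⟩⟩
  have hmem' : ∀ x ∈ Ioo (D / 2) D, φ x ∈ Ioo (-(piP p / 2)) (piP p / 2) := fun x hx =>
    ⟨by linarith [(hmem x hx).1], (hmem x hx).2⟩
  have hsin : ∀ x ∈ Ioo (D / 2) D, 0 < sinP p (φ x) := fun x hx =>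
    sinP_pos hp (hmem x hx).1 (hmem x hx).2.le
  have hcos : ∀ x ∈ Ioo (D / 2) D, 0 < cosP p (φ x) := fun x hx => cosP_pos hp (hmem' x hx)
  have hIoo : ∀ x ∈ Ioo (D / 2) D, x ∈ Ioo 0 D := fun x hx => ⟨by linarith [hx.1], hx.2⟩
  set m := modelWeight K N with hm
  set r : ℝ → ℝ := fun x => α * (cosP p (φ x) / sinP p (φ x)) with hr
  set G : ℝ → ℝ := fun x => m x * r x ^ (p - 1) with hG
  have hr0 : ∀ x ∈ Ioo (D / 2) D, 0 < r x := fun x hx =>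
    mul_pos hα (div_pos (hcos x hx) (hsin x hx))
  -- The Riccati equation for `r ^ (p - 1)`; the `cotKN` term is cancelled by the derivative of the
  -- weight in `G`.
  have hrd : ∀ x ∈ Ioo (D / 2) D, HasDerivAt (fun x => r x ^ (p - 1))
      (-((p - 1) * α ^ p + (p - 1) * r x ^ p + cotKN K N x * r x ^ (p - 1))) x := by
    intro x hx
    have h1 := ((hasDerivAt_cot_rpow hp (hmem x hx)).comp x
      (h.deriv_Ioo hx)).const_mul (α ^ (p - 1))
    have heq : (fun x => r x ^ (p - 1)) =ᶠ[nhds x]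
        fun x => α ^ (p - 1) * ((fun y => (cosP p y / sinP p y) ^ (p - 1)) ∘ φ) x := by
      filter_upwards [Ioo_mem_nhds hx.1 hx.2] with z hz
      simp only [hr, Function.comp]
      exact Real.mul_rpow hα.le (div_pos (hcos z hz) (hsin z hz)).le
    refine (h1.congr_of_eventuallyEq heq).congr_deriv ?_
    have hs := hsin x hx
    have hc := hcos x hx
    have e1 := cosP_rpow hp (hmem' x hx)
    rw [abs_of_pos hs] at e1
    simp only [hr]
    rw [phaseF_eq hp ⟨(hmem x hx).1.le, (hmem x hx).2⟩,
      Real.mul_rpow hα.le (div_pos hc hs).le, Real.mul_rpow hα.le (div_pos hc hs).le,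
      Real.div_rpow hc.le hs.le, Real.div_rpow hc.le hs.le, e1]
    have e2 : α ^ p = α ^ (p - 1) * α := by
      rw [Real.rpow_sub_one hα.ne', div_mul_cancel₀ _ hα.ne']
    have e3 : sinP p (φ x) ^ p = sinP p (φ x) ^ (p - 1) * sinP p (φ x) := by
      rw [Real.rpow_sub_one hs.ne', div_mul_cancel₀ _ hs.ne']
    have hS := Real.rpow_pos_of_pos hs (p - 1)
    rw [e2, e3]
    field_simp
    ring
  have hGd : ∀ x ∈ Ioo (D / 2) D,
      HasDerivAt G (-(m x * ((p - 1) * α ^ p + (p - 1) * r x ^ p))) x := by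
    intro x hx
    refine ((hasDerivAt_modelWeight hN hDK (hIoo x hx)).mul (hrd x hx)).congr_deriv ?_
    simp only [hm]; ring
  have hrc : ContinuousOn r (Ioo (D / 2) D) := by
    have h1 : ContinuousOn (fun x => (r x ^ (p - 1)) ^ (1 / (p - 1))) (Ioo (D / 2) D) :=
      ContinuousOn.rpow_const (fun x hx => (hrd x hx).continuousAt.continuousWithinAt)
        fun x _ => Or.inr (by positivity)
    refine h1.congr fun x hx => ?_
    simp only
    rw [← Real.rpow_mul (hr0 x hx).le, mul_one_div_cancel hp1.ne', Real.rpow_one]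
  have hmc : ContinuousOn m (Icc (D / 2) t) := (continuousOn_modelWeight hN hDK).mono
    fun x hx => ⟨by linarith [hx.1], hx.2.trans_lt ht.2⟩
  obtain ⟨B, hB⟩ := isCompact_Icc.exists_bound_of_continuousOn hmc
  have hII := intervalIntegrable_energy (lam := (p - 1) * α ^ p) (by linarith : 0 ≤ p) hv
    (by rwa [uIcc_of_le ht.1.le] : ContinuousOn m (uIcc (D / 2) t))
  have hpic : ∀ y ∈ Ioo (D / 2) t, -(G y * |v y| ^ p)
      ≤ ∫ x in y..t, m x * (|deriv v x| ^ p - (p - 1) * α ^ p * |v x| ^ p) := by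
    intro y hy
    have hsub : ∀ x ∈ Icc y t, x ∈ Ioo (D / 2) D := fun x hx =>
      ⟨hy.1.trans_le hx.1, hx.2.trans_lt ht.2⟩
    have h1 := picone hp (lam := (p - 1) * α ^ p) (G := G) hy.2.le hv
      (hmc.mono (Icc_subset_Icc_left hy.1.le))
      (fun x hx => (modelWeight_pos hN hDK (hIoo x (hsub x hx))).le) (hrc.mono hsub)
      (fun x hx => hr0 x (hsub x hx)) (fun x _ => rfl) (fun x hx => hGd x (hsub x hx))
    have h2 : 0 ≤ G t * |v t| ^ p := by
      have h3 := (modelWeight_pos hN hDK (hIoo t ht)).le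
      have h4 := (hr0 t ht).le
      simp only [hG]
      positivity
    linarith
  -- the boundary term at `D / 2` vanishes in the limit
  have hslope : ∀ᶠ y in nhdsWithin (D / 2) (Ioi (D / 2)),
      α / 2 * (y - D / 2) ≤ sinP p (φ y) := by
    have h1 := h.deriv_Ici (x := D / 2) ⟨le_rfl, by linarith⟩
    rw [h.init, hF0, mul_zero, add_zero] at h1
    have h2 : HasDerivAt (sinP p) 1 (φ (D / 2)) := by
      rw [h.init]
      have := hasDerivAt_sinP hp (y := 0) ⟨by linarith, by linarith⟩
      simpa [sinP_zero hp, Real.zero_rpow (by linarith : p ≠ 0)] using this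
    have h3 := (h2.comp_hasDerivWithinAt (D / 2) h1).mono Ioi_subset_Ici_self
    rw [one_mul, hasDerivWithinAt_iff_tendsto_slope' (by simp)] at h3
    have h4 := h3.eventually (lt_mem_nhds (by linarith : α / 2 < α))
    filter_upwards [h4, self_mem_nhdsWithin] with y hy hy'
    have hpos : 0 < y - D / 2 := sub_pos.2 hy'
    rw [slope_def_field, Function.comp, Function.comp, h.init, sinP_zero hp, sub_zero,
      lt_div_iff₀ hpos] at hy
    exact hy.le
  have hvb : ∀ y, D / 2 < y → |v y| ≤ C * (y - D / 2) := by
    intro y hy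
    have := hv.dist_le_mul y (D / 2)
    rwa [hv0, Real.dist_eq, Real.dist_eq, sub_zero, abs_of_pos (sub_pos.2 hy)] at this
  have hev : ∀ᶠ y in nhdsWithin (D / 2) (Ioi (D / 2)),
      -(B * (2 * C) ^ (p - 1) * (C * (y - D / 2)))
        ≤ ∫ x in y..t, m x * (|deriv v x| ^ p - (p - 1) * α ^ p * |v x| ^ p) := by
    filter_upwards [hslope, Ioo_mem_nhdsGT ht.1] with y hy hyt
    refine le_trans ?_ (hpic y hyt)
    have hyI : y ∈ Ioo (D / 2) D := ⟨hyt.1, hyt.2.trans ht.2⟩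
    have hs := hsin y hyI
    have hδ : 0 < y - D / 2 := sub_pos.2 hyt.1
    -- `r` blows up at most like `2 / (y - D/2)`, by the slope bound `α / 2` on `sin_p ∘ φ`, while
    -- `|v| ≤ C (y - D/2)`. Hence `G |v|^p = m (r |v|)^{p-1} |v|` is `O(y - D/2)`.
    have hrv : r y * |v y| ≤ 2 * C := by
      have hc1 : cosP p (φ y) ≤ 1 := by
        rw [cosP_eq hp (hmem' y hyI)]
        refine Real.rpow_le_one (one_sub_abs_rpow_pos hp
          (abs_lt.2 (sinP_mem_Ioo hp (hmem' y hyI)))).le ?_ (by positivity)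
        have : 0 ≤ |sinP p (φ y)| ^ p := by positivity
        linarith
      have : r y ≤ 2 / (y - D / 2) := by
        simp only [hr]
        rw [← mul_div_assoc, div_le_div_iff₀ hs hδ]
        calc α * cosP p (φ y) * (y - D / 2) ≤ α * 1 * (y - D / 2) := by gcongr
          _ = 2 * (α / 2 * (y - D / 2)) := by ring
          _ ≤ 2 * sinP p (φ y) := by gcongr
      calc r y * |v y| ≤ 2 / (y - D / 2) * (C * (y - D / 2)) := by
            gcongr
            exact hvb y hyt.1
        _ = 2 * C := by
            have hne := hδ.ne'
            generalize y - D / 2 = d at hne ⊢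
            field_simp
    have hm0 := (modelWeight_pos hN hDK (hIoo y hyI)).le
    have hmB : m y ≤ B := (le_abs_self _).trans (hB y ⟨hyt.1.le, hyt.2.le⟩)
    have hr0' := hr0 y hyI
    have key : G y * |v y| ^ p = m y * (r y * |v y|) ^ (p - 1) * |v y| := by
      simp only [hG]
      rw [Real.mul_rpow hr0'.le (abs_nonneg _)]
      have : |v y| ^ p = |v y| ^ (p - 1) * |v y| := by
        rcases eq_or_ne (v y) 0 with h0 | h0
        · simp [h0, Real.zero_rpow (by linarith : p ≠ 0)]
        · rw [Real.rpow_sub_one (abs_pos.2 h0).ne', div_mul_cancel₀ _ (abs_pos.2 h0).ne']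
      rw [this]; ring
    rw [key, neg_le_neg_iff]
    have hB0 : 0 ≤ B := hm0.trans hmB
    have : (r y * |v y|) ^ (p - 1) ≤ (2 * C) ^ (p - 1) :=
      Real.rpow_le_rpow (by positivity) hrv hp1.le
    have h5 := hvb y hyt.1
    gcongr
  have hlim1 : Filter.Tendsto (fun y => -(B * (2 * C) ^ (p - 1) * (C * (y - D / 2))))
      (nhdsWithin (D / 2) (Ioi (D / 2))) (nhds 0) := by
    have : Continuous fun y : ℝ => -(B * (2 * (C : ℝ)) ^ (p - 1) * (C * (y - D / 2))) := by
      fun_prop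
    have := (this.tendsto (D / 2)).mono_left (nhdsWithin_le_nhds (s := Ioi (D / 2)))
    simpa using this
  have hlim2 : Filter.Tendsto
      (fun y => ∫ x in y..t, m x * (|deriv v x| ^ p - (p - 1) * α ^ p * |v x| ^ p))
      (nhdsWithin (D / 2) (Ioi (D / 2)))
      (nhds (∫ x in D / 2..t, m x * (|deriv v x| ^ p - (p - 1) * α ^ p * |v x| ^ p))) := by
    have h1 := intervalIntegral.continuousOn_primitive_interval_left
      ((intervalIntegrable_iff_integrableOn_Icc_of_le ht.1.le).1 hII |>.mono_set
        (by rw [uIcc_of_le ht.1.le]))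
    rw [uIcc_of_le ht.1.le] at h1
    have h2 := h1 (D / 2) ⟨le_rfl, ht.1.le⟩
    refine Filter.Tendsto.mono_left h2 (nhdsWithin_le_of_mem ?_)
    exact Filter.mem_of_superset (Ioo_mem_nhdsGT ht.1) Ioo_subset_Icc_self
  exact le_of_tendsto_of_tendsto hlim1 hlim2 hev

/-- If all the initial integrals of `f` are nonnegative, so is the integral of `k f` for every
nonnegative nonincreasing `k`. -/
lemma integral_antitoneOn_mul_nonneg {f k : ℝ → ℝ} {a t : ℝ} (hat : a ≤ t)
    (hf : IntegrableOn f (Ioc a t)) (hF : ∀ s ∈ Icc a t, 0 ≤ ∫ x in a..s, f x)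
    (hkm : Measurable k) (hk : AntitoneOn k (Icc a t)) (hk0 : ∀ x ∈ Icc a t, 0 ≤ k x) :
    0 ≤ ∫ x in a..t, k x * f x := by
  -- Layer cake: write `k x` as the measure of `{τ ∈ (0, k a] | τ ≤ k x}` and exchange the
  -- integrals. Each superlevel set of `k` is an initial interval up to a null set, where `hF`
  -- applies.
  set E : Set (ℝ × ℝ) := {z | z.2 ≤ k z.1} with hE
  have hEm : MeasurableSet E := measurableSet_le measurable_snd (hkm.comp measurable_fst)
  have h1 : ∀ x ∈ Ioc a t, ∫ τ in Ioc 0 (k a), E.indicator (fun z => f z.1) (x, τ)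
      = k x * f x := by
    intro x hx
    have hx' : x ∈ Icc a t := ⟨hx.1.le, hx.2⟩
    have h2 : (fun τ => E.indicator (fun z => f z.1) (x, τ))
        = (Iic (k x)).indicator fun _ => f x := by
      funext τ
      simp only [indicator, hE, mem_ofPred_eq, mem_Iic]
    rw [h2, setIntegral_indicator measurableSet_Iic, setIntegral_const]
    have h3 : Ioc 0 (k a) ∩ Iic (k x) = Ioc 0 (k x) := by
      rw [Ioc_inter_Iic, inf_eq_right.2 (hk ⟨le_rfl, hat⟩ hx' hx'.1)]
    rw [h3, Real.volume_real_Ioc_of_le (hk0 x hx'), sub_zero, smul_eq_mul]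
  rw [intervalIntegral.integral_of_le hat]
  rw [← setIntegral_congr_fun measurableSet_Ioc h1]
  rw [integral_integral_swap (f := fun x τ => E.indicator (fun z : ℝ × ℝ => f z.1) (x, τ))]
  swap
  · exact (hf.integrable.comp_fst _).indicator hEm
  refine integral_nonneg fun τ => ?_
  simp only [Pi.zero_apply]
  have h2 : (fun x => E.indicator (fun z : ℝ × ℝ => f z.1) (x, τ))
      = {x | τ ≤ k x}.indicator f := by
    funext x
    simp only [indicator, hE, mem_ofPred_eq]
  rw [h2, setIntegral_indicator (measurableSet_le measurable_const hkm)]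
  set S := Ioc a t ∩ {x | τ ≤ k x} with hS
  rcases S.eq_empty_or_nonempty with h0 | hne
  · rw [h0]; simp
  have hbdd : BddAbove S := ⟨t, fun x hx => hx.1.2⟩
  set s := sSup S with hs
  obtain ⟨x₀, hx₀⟩ := hne
  have has : a ≤ s := hx₀.1.1.le.trans (le_csSup hbdd hx₀)
  have hst : s ≤ t := csSup_le ⟨x₀, hx₀⟩ fun x hx => hx.1.2
  have hsub1 : Ioo a s ⊆ S := by
    intro x hx
    obtain ⟨z, hz, hxz⟩ := exists_lt_of_lt_csSup ⟨x₀, hx₀⟩ hx.2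
    refine ⟨⟨hx.1, hx.2.le.trans hst⟩, (?_ : τ ≤ k x)⟩
    exact (show τ ≤ k z from hz.2).trans <| hk ⟨hx.1.le, hx.2.le.trans hst⟩ ⟨hz.1.1.le, hz.1.2⟩ hxz.le
  have hsub2 : S ⊆ Ioc a s := fun x hx => ⟨hx.1.1, le_csSup hbdd hx⟩
  have hae : S =ᵐ[volume] Ioc a s := by
    refine Filter.EventuallyLE.antisymm hsub2.eventuallyLE ?_
    exact (Ioo_ae_eq_Ioc (a := a) (b := s)).symm.le.trans hsub1.eventuallyLE
  rw [setIntegral_congr_set hae, ← intervalIntegral.integral_of_le has]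
  exact hF s ⟨has, hst⟩

end Picone

/-! ### Comparison of `MCP` densities with the model weight -/

section Comparison

open Set

variable {p K N D : ℝ}

lemma measurable_modelWeight (K N : ℝ) : Measurable (modelWeight K N) := by
  unfold modelWeight snKN
  split_ifs <;> fun_prop

lemma sigma_eq (hN : 1 < N) (hDK : (D : EReal) ≤ diamBound K N) {x y : ℝ} (hx : x ∈ Ioo 0 D) :
    sigma K (N - 1) (y / x) x = ENNReal.ofReal (snKN K N y / snKN K N x) := by
  have hN' : 0 < N - 1 := by linarith
  have hx2 : 0 < x ^ 2 := pow_pos hx.1 2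
  have hx0 := hx.1.ne'
  have e : ∀ k : ℝ, y / x * x * k = k * y := fun k => by field_simp
  rcases lt_trichotomy K 0 with hK | hK | hK
  · have h1 : ¬ 0 < K := by linarith
    have h2 : K * x ^ 2 < 0 := mul_neg_of_neg_of_pos hK hx2
    have h3 : 0 ≤ (N - 1) * Real.pi ^ 2 := by positivity
    rw [sigma, if_neg (by linarith), if_neg (by linarith), if_neg h2.ne, e, mul_comm x]
    simp only [snKN, h1, hK.ne, if_false]
  · subst hK
    have h3 : 0 < (N - 1) * Real.pi ^ 2 := by positivity
    rw [sigma, if_neg (by simpa using h3), if_neg (by simp), if_pos (by simp)]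
    simp [snKN]
  · have h1 : 0 < K * x ^ 2 := mul_pos hK hx2
    have h2 := mul_lt_pi_of_le_diamBound hN hDK hK hx.2
    have h3 : ¬ (N - 1) * Real.pi ^ 2 ≤ K * x ^ 2 := by
      have h4 : (√(K / (N - 1)) * x) ^ 2 < Real.pi ^ 2 :=
        pow_lt_pow_left₀ h2 (mul_nonneg (Real.sqrt_nonneg _) hx.1.le) two_ne_zero
      rw [mul_pow, Real.sq_sqrt (by positivity)] at h4
      have h5 : K * x ^ 2 = (N - 1) * (K / (N - 1) * x ^ 2) := by field_simp
      rw [h5, not_le]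
      exact mul_lt_mul_of_pos_left h4 hN'
    rw [sigma, if_neg h3, if_pos h1, e, mul_comm x]
    simp only [snKN, hK, if_true]

/-- Inside the diameter bound the distortion coefficient is a quotient of generalized sines, so
contraction towards the pole `x₁` is monotonicity of density over weight; `x` and `y` are distances
to the pole. -/
lemma IsMCPDensity.le_of_contraction {h : ℝ → ℝ} (hh : IsMCPDensity K N h) (hN : 1 < N)
    (hDK : (D : EReal) ≤ diamBound K N) {x₀ x₁ x y : ℝ} (hx₀ : x₀ ∈ tsupport h)
    (hx₁ : x₁ ∈ tsupport h) (hy : 0 < y) (hyx : y ≤ x) (hx : x < D) (hxx : |x₁ - x₀| = x) :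
    h x₀ / modelWeight K N x ≤ h ((1 - y / x) * x₁ + y / x * x₀) / modelWeight K N y := by
  have hx0 : 0 < x := hy.trans_le hyx
  have hxI : x ∈ Ioo 0 D := ⟨hx0, hx⟩
  have hyI : y ∈ Ioo 0 D := ⟨hy, hyx.trans_lt hx⟩
  have h1 : 0 ≤ 1 - y / x := sub_nonneg.2 ((div_le_one hx0).2 hyx)
  have h2 : 1 - y / x ≤ 1 := by linarith [div_pos hy hx0]
  have h3 := hh.contraction x₀ hx₀ x₁ hx₁ (1 - y / x) ⟨h1, h2⟩
  have hsx := snKN_pos hN hDK hxI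
  have hsy := snKN_pos hN hDK hyI
  rw [sub_sub_cancel, hxx, sigma_eq hN hDK hxI, ENNReal.ofReal_rpow_of_pos (div_pos hsy hsx),
    ← ENNReal.ofReal_mul (by positivity), ENNReal.ofReal_le_ofReal_iff (hh.nonneg _),
    Real.div_rpow hsy.le hsx.le] at h3
  rw [le_div_iff₀ (modelWeight_pos hN hDK hyI)]
  refine le_trans (le_of_eq ?_) h3
  simp only [modelWeight]
  ring

lemma tsupport_eq_Icc {h : ℝ → ℝ} (hh : h ∈ densities K N D) (hDK : (D : EReal) ≤ diamBound K N) :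
    tsupport h = Icc 0 D := by
  rw [hh.2]
  ext x
  simp only [mem_ofPred_eq, mem_Icc]
  exact ⟨fun hx => ⟨hx.1, hx.2.1⟩,
    fun hx => ⟨hx.1, hx.2, (EReal.coe_le_coe_iff.2 hx.2).trans hDK⟩⟩

lemma density_div_modelWeight_antitone {h : ℝ → ℝ} (hh : h ∈ densities K N D) (hN : 1 < N)
    (hD : 0 < D) (hDK : (D : EReal) ≤ diamBound K N) :
    AntitoneOn (fun x => h x / modelWeight K N x) (Ioo 0 D) := by
  have ht := tsupport_eq_Icc hh hDK
  intro y hy x hx hyx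
  have := hh.1.le_of_contraction hN hDK (x₀ := x) (x₁ := 0) (by rw [ht]; exact ⟨hx.1.le, hx.2.le⟩)
    (by rw [ht]; exact ⟨le_rfl, hD.le⟩) hy.1 hyx hx.2 (by rw [zero_sub, abs_neg, abs_of_pos hx.1])
  rwa [mul_zero, zero_add, div_mul_cancel₀ _ hx.1.ne'] at this

lemma density_reflect_div_modelWeight_antitone {h : ℝ → ℝ} (hh : h ∈ densities K N D) (hN : 1 < N)
    (hD : 0 < D) (hDK : (D : EReal) ≤ diamBound K N) :
    AntitoneOn (fun x => h (D - x) / modelWeight K N x) (Ioo 0 D) := by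
  have ht := tsupport_eq_Icc hh hDK
  intro y hy x hx hyx
  have := hh.1.le_of_contraction hN hDK (x₀ := D - x) (x₁ := D)
    (by rw [ht]; exact ⟨by linarith [hx.2], by linarith [hx.1]⟩)
    (by rw [ht]; exact ⟨hD.le, le_rfl⟩) hy.1 hyx hx.2
    (by rw [sub_sub_cancel, abs_of_pos hx.1])
  have e : (1 - y / x) * D + y / x * (D - x) = D - y := by
    have := hx.1.ne'
    field_simp
    ring
  rwa [e] at this

/-- `h` is positive at some `z ∈ (x, D)` because of its support, and the nonincreasing quotient
carries positivity back to `x`. -/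
lemma density_pos {h : ℝ → ℝ} (hh : h ∈ densities K N D) (hN : 1 < N)
    (hD : 0 < D) (hDK : (D : EReal) ≤ diamBound K N) {x : ℝ} (hx : x ∈ Ioo 0 D) : 0 < h x := by
  have ht := tsupport_eq_Icc hh hDK
  have hmid : (x + D) / 2 ∈ closure (Function.support h) := by
    change _ ∈ tsupport h
    rw [ht]
    exact ⟨by linarith [hx.1], by linarith [hx.2]⟩
  obtain ⟨z, hz, hzs⟩ := mem_closure_iff.1 hmid (Ioo x D) isOpen_Ioo
    ⟨by linarith [hx.2], by linarith [hx.2]⟩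
  have hzI : z ∈ Ioo 0 D := ⟨hx.1.trans hz.1, hz.2⟩
  have hzpos : 0 < h z := lt_of_le_of_ne (hh.1.nonneg z) (Ne.symm hzs)
  have h1 := density_div_modelWeight_antitone hh hN hD hDK hx hzI hz.1.le
  have h2 := div_pos hzpos (modelWeight_pos hN hDK hzI)
  have h3 := h2.trans_le h1
  have hm := modelWeight_pos hN hDK hx
  have := mul_pos h3 hm
  rwa [div_mul_cancel₀ _ hm.ne'] at this

/-! ### Energy inequalities for MCP densities -/

lemma integrable_mul_deriv_rpow {h v : ℝ → ℝ} {C : NNReal} (hp : 0 ≤ p) (hv : LipschitzWith C v)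
    {μ : Measure ℝ} (hi : Integrable h μ) : Integrable (fun x => h x * |deriv v x| ^ p) μ := by
  refine hi.mul_bdd (c := (C : ℝ) ^ p)
    (((measurable_deriv v).abs.pow_const p).aestronglyMeasurable) ?_
  refine Filter.Eventually.of_forall fun x => ?_
  rw [Real.norm_of_nonneg (by positivity)]
  exact Real.rpow_le_rpow (abs_nonneg _) (norm_deriv_le_of_lipschitz hv) hp

lemma intervalIntegrable_mul_of_continuous {h f : ℝ → ℝ} {a b : ℝ} (hi : Integrable h)
    (hf : Continuous f) : IntervalIntegrable (fun x => h x * f x) volume a b :=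
  (hi.intervalIntegrable).mul_continuousOn hf.continuousOn

lemma continuous_abs_comp_rpow {v : ℝ → ℝ} (hv : Continuous v) (hp : 0 ≤ p) :
    Continuous fun x => |v x| ^ p :=
  hv.abs.rpow_const fun _ => Or.inr hp

/-- For `p < 2` the second factor is singular at `0`; the product is `1 / p` times the derivative of
the `C¹` function `|z|^p`. -/
lemma continuous_abs_rpow_mul_self (hp : 1 < p) : Continuous fun z : ℝ => z * |z| ^ (p - 2) := by
  have h1 : Continuous (deriv fun x : ℝ => ‖x‖ ^ p) :=
    (contDiff_norm_rpow hp).continuous_deriv le_rfl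
  have h2 : (fun z : ℝ => z * |z| ^ (p - 2)) = fun z => deriv (fun x : ℝ => ‖x‖ ^ p) z / p := by
    funext z
    have := (hasDerivAt_abs_rpow z hp).deriv
    simp only [Real.norm_eq_abs, this]
    have : p ≠ 0 := by linarith
    field_simp
  rw [h2]
  exact h1.div_const p

/-- The Dirichlet–Neumann inequality on the right half, for densities with
`h / modelWeight` nonincreasing. -/
theorem integral_half_energy_nonneg (hp : 1 < p) (hN : 1 < N) (hD : 0 < D)
    (hDK : (D : EReal) ≤ diamBound K N) {α : ℝ} {φ : ℝ → ℝ} (hα : 0 < α)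
    (hφ : IsPhase (phaseF p) (fun x => cotKN K N x / (p - 1)) (D / 2) D α φ)
    (hφP : ∀ x ∈ Ico (D / 2) D, φ x < piP p / 2) {h : ℝ → ℝ} (hm : Measurable h)
    (h0 : ∀ x, 0 ≤ h x) (hi : Integrable h)
    (hanti : AntitoneOn (fun x => h x / modelWeight K N x) (Ioo 0 D))
    {v : ℝ → ℝ} {C : NNReal} (hv : LipschitzWith C v) (hv0 : v (D / 2) = 0) :
    0 ≤ ∫ x in D / 2..D, h x * (|deriv v x| ^ p - (p - 1) * α ^ p * |v x| ^ p) := by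
  set W : ℝ → ℝ := fun x => |deriv v x| ^ p - (p - 1) * α ^ p * |v x| ^ p with hW
  have hab : D / 2 < D := by linarith
  have hII : IntervalIntegrable (fun x => h x * W x) volume (D / 2) D := by
    have h1 : IntervalIntegrable (fun x => h x * |deriv v x| ^ p) volume (D / 2) D :=
      (integrable_mul_deriv_rpow (by linarith) hv hi).intervalIntegrable
    have h2 : IntervalIntegrable (fun x => h x * ((p - 1) * α ^ p * |v x| ^ p)) volume (D / 2) D :=
      intervalIntegrable_mul_of_continuous hi
        ((continuous_abs_comp_rpow hv.continuous (by linarith)).const_mul _)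
    refine (h1.sub h2).congr fun x _ => ?_
    simp only [hW]; ring
  -- The weight may vanish at `D`, so the quotient is used only on `[D/2, t]` and `t → D` is taken
  -- afterwards.
  have hpart : ∀ t ∈ Ioo (D / 2) D, 0 ≤ ∫ x in D / 2..t, h x * W x := by
    intro t ht
    have hsub : ∀ x ∈ Icc (D / 2) t, x ∈ Ioo 0 D := fun x hx =>
      ⟨by linarith [hx.1], hx.2.trans_lt ht.2⟩
    have hmW : IntervalIntegrable (fun x => modelWeight K N x * W x) volume (D / 2) t :=
      intervalIntegrable_energy (by linarith) hv
        ((continuousOn_modelWeight hN hDK).mono fun x hx => hsub x (by rwa [← uIcc_of_le ht.1.le]))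
    have key := integral_antitoneOn_mul_nonneg ht.1.le
      ((intervalIntegrable_iff_integrableOn_Ioc_of_le ht.1.le).1 hmW) (fun s hs => ?_)
      (k := fun x => h x / modelWeight K N x) (hm.div (measurable_modelWeight K N))
      (hanti.mono hsub) (fun x hx => div_nonneg (h0 x) (modelWeight_pos hN hDK (hsub x hx)).le)
    · refine key.trans_eq (intervalIntegral.integral_congr fun x hx => ?_)
      rw [uIcc_of_le ht.1.le] at hx
      have := (modelWeight_pos hN hDK (hsub x hx)).ne'
      show h x / modelWeight K N x * (modelWeight K N x * W x) = h x * W x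
      field_simp
    · rcases hs.1.eq_or_lt with h' | h'
      · rw [h', intervalIntegral.integral_same]
      · exact integral_modelWeight_energy_nonneg hp hN hD hDK hα hφ hφP hv hv0
          ⟨h', hs.2.trans_lt ht.2⟩
  have hcont := intervalIntegral.continuousOn_primitive_interval
    ((intervalIntegrable_iff_integrableOn_Icc_of_le hab.le).1 hII |>.mono_set
      (by rw [uIcc_of_le hab.le]))
  rw [uIcc_of_le hab.le] at hcont
  have hlim : Filter.Tendsto (fun t => ∫ x in D / 2..t, h x * W x) (nhdsWithin D (Iio D))
      (nhds (∫ x in D / 2..D, h x * W x)) := by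
    refine Filter.Tendsto.mono_left (hcont D ⟨hab.le, le_rfl⟩) (nhdsWithin_le_of_mem ?_)
    exact Filter.mem_of_superset (Ioo_mem_nhdsLT hab) Ioo_subset_Icc_self
  refine ge_of_tendsto hlim ?_
  filter_upwards [Ioo_mem_nhdsLT hab] with t ht using hpart t ht

/-- The energy inequality on the whole interval, for functions vanishing at the midpoint. -/
theorem integral_energy_nonneg (hp : 1 < p) (hN : 1 < N) (hD : 0 < D)
    (hDK : (D : EReal) ≤ diamBound K N) {α : ℝ} {φ : ℝ → ℝ} (hα : 0 < α)
    (hφ : IsPhase (phaseF p) (fun x => cotKN K N x / (p - 1)) (D / 2) D α φ)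
    (hφP : ∀ x ∈ Ico (D / 2) D, φ x < piP p / 2) {h : ℝ → ℝ} (hh : h ∈ densities K N D)
    {v : ℝ → ℝ} {C : NNReal} (hv : LipschitzWith C v) (hv0 : v (D / 2) = 0) :
    (p - 1) * α ^ p * ∫ x in 0..D, h x * |v x| ^ p ≤ ∫ x in 0..D, h x * |deriv v x| ^ p := by
  have hi := hh.1.integrable
  have h1 := integral_half_energy_nonneg hp hN hD hDK hα hφ hφP hh.1.measurable hh.1.nonneg hi
    (density_div_modelWeight_antitone hh hN hD hDK) hv hv0
  have hvr : LipschitzWith C fun x => v (D - x) := by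
    refine LipschitzWith.of_dist_le_mul fun x y => ?_
    refine (hv.dist_le_mul _ _).trans_eq ?_
    rw [dist_sub_left]
  have h2 := integral_half_energy_nonneg hp hN hD hDK hα hφ hφP
    (h := fun x => h (D - x)) (hh.1.measurable.comp (by fun_prop)) (fun x => hh.1.nonneg _)
    (hi.comp_sub_left D) (density_reflect_div_modelWeight_antitone hh hN hD hDK) hvr
    (by rw [show D - D / 2 = D / 2 by ring, hv0])
  simp only [deriv_comp_const_sub, abs_neg] at h2
  rw [intervalIntegral.integral_comp_sub_left
    (fun x => h x * (|deriv v x| ^ p - (p - 1) * α ^ p * |v x| ^ p)) D, sub_self,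
    show D - D / 2 = D / 2 by ring] at h2
  have hI1 : ∀ a b : ℝ, IntervalIntegrable (fun x => h x * |deriv v x| ^ p) volume a b :=
    fun a b => (integrable_mul_deriv_rpow (by linarith) hv hi).intervalIntegrable
  have hI2 : ∀ a b : ℝ, IntervalIntegrable (fun x => h x * |v x| ^ p) volume a b := fun a b =>
    intervalIntegrable_mul_of_continuous hi (continuous_abs_comp_rpow hv.continuous (by linarith))
  have e : ∀ a b : ℝ, ∫ x in a..b, h x * (|deriv v x| ^ p - (p - 1) * α ^ p * |v x| ^ p)
      = (∫ x in a..b, h x * |deriv v x| ^ p)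
        - (p - 1) * α ^ p * ∫ x in a..b, h x * |v x| ^ p := by
    intro a b
    rw [← intervalIntegral.integral_const_mul, ← intervalIntegral.integral_sub (hI1 a b)
      ((hI2 a b).const_mul _)]
    refine intervalIntegral.integral_congr fun x _ => ?_
    ring
  rw [e] at h1 h2
  rw [← intervalIntegral.integral_add_adjacent_intervals (hI1 0 (D / 2)) (hI1 (D / 2) D),
    ← intervalIntegral.integral_add_adjacent_intervals (hI2 0 (D / 2)) (hI2 (D / 2) D)]
  linarith

/-- A function with vanishing `p`-mean minimizes the `L^p` norm among its translates. -/
lemma integral_rpow_le_integral_sub_rpow (hp : 1 < p) {h u : ℝ → ℝ} (hD : 0 ≤ D)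
    (h0 : ∀ x, 0 ≤ h x) (hi : Integrable h) (hu : Continuous u)
    (hmean : ∫ x in 0..D, h x * (u x * |u x| ^ (p - 2)) = 0) (a : ℝ) :
    ∫ x in 0..D, h x * |u x| ^ p ≤ ∫ x in 0..D, h x * |u x - a| ^ p := by
  have hI1 : IntervalIntegrable (fun x => h x * |u x| ^ p) volume 0 D :=
    intervalIntegrable_mul_of_continuous hi (continuous_abs_comp_rpow hu (by linarith))
  have hI2 : IntervalIntegrable (fun x => h x * |u x - a| ^ p) volume 0 D :=
    intervalIntegrable_mul_of_continuous hi
      (continuous_abs_comp_rpow (hu.sub continuous_const) (by linarith))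
  have hI3 : IntervalIntegrable (fun x => h x * (u x * |u x| ^ (p - 2))) volume 0 D :=
    intervalIntegrable_mul_of_continuous hi ((continuous_abs_rpow_mul_self hp).comp hu)
  have key : ∫ x in 0..D, (h x * |u x| ^ p - p * a * (h x * (u x * |u x| ^ (p - 2))))
      ≤ ∫ x in 0..D, h x * |u x - a| ^ p := by
    refine intervalIntegral.integral_mono_on hD (hI1.sub (hI3.const_mul _)) hI2 fun x _ => ?_
    -- The term of this tangent bound that is linear in `a` integrates to zero by `hmean`.
    have hy := young_tangent hp (u x) (u x - a)
    have e : |u x| ^ (p - 2) * u x * u x = |u x| ^ p := by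
      rcases eq_or_ne (u x) 0 with hz | hz
      · simp [hz, Real.zero_rpow (by linarith : p ≠ 0)]
      · have := abs_pos.2 hz
        rw [mul_assoc, ← sq, ← sq_abs, ← Real.rpow_natCast, ← Real.rpow_add this]
        congr 1; push_cast; ring
    have hy2 : |u x| ^ p - p * a * (u x * |u x| ^ (p - 2)) ≤ |u x - a| ^ p := by
      have : p * (|u x| ^ (p - 2) * u x) * (u x - a)
          = p * (|u x| ^ (p - 2) * u x * u x) - p * a * (u x * |u x| ^ (p - 2)) := by ring
      rw [this, e] at hy
      linarith
    have := mul_le_mul_of_nonneg_left hy2 (h0 x)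
    linarith
  rw [intervalIntegral.integral_sub hI1 (hI3.const_mul _), intervalIntegral.integral_const_mul,
    hmean] at key
  linarith

/-! ### Rayleigh quotients and admissible functions -/

lemma integral_mul_density_eq {h f : ℝ → ℝ} (hD : 0 ≤ D) (ht : tsupport h = Icc 0 D) :
    ∫ x, f x * h x = ∫ x in 0..D, h x * f x := by
  rw [intervalIntegral.integral_of_le hD, ← integral_Icc_eq_integral_Ioc,
    setIntegral_eq_integral_of_forall_compl_eq_zero]
  · exact integral_congr_ae (Filter.Eventually.of_forall fun x => mul_comm _ _)
  · intro x hx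
    rw [← ht] at hx
    rw [image_eq_zero_of_notMem_tsupport hx, zero_mul]

lemma integral_mul_abs_rpow_pos {h u : ℝ → ℝ} (hp : 1 < p) (hN : 1 < N) (hD : 0 < D)
    (hDK : (D : EReal) ≤ diamBound K N) (hh : h ∈ densities K N D) (hu : Continuous u)
    {x₀ : ℝ} (hx₀ : x₀ ∈ Icc 0 D) (hux : u x₀ ≠ 0) :
    0 < ∫ x in 0..D, h x * |u x| ^ p := by
  have hnn : ∀ x, 0 ≤ h x * |u x| ^ p := fun x =>
    mul_nonneg (hh.1.nonneg x) (Real.rpow_nonneg (abs_nonneg _) _)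
  have hI : IntervalIntegrable (fun x => h x * |u x| ^ p) volume 0 D :=
    intervalIntegrable_mul_of_continuous hh.1.integrable
      (continuous_abs_comp_rpow hu (by linarith))
  refine lt_of_le_of_ne (intervalIntegral.integral_nonneg hD.le fun x _ => hnn x) fun h0 => hux ?_
  rw [intervalIntegral.integral_of_le hD.le, eq_comm, setIntegral_eq_zero_iff_of_nonneg_ae
    (Filter.Eventually.of_forall hnn)
    ((intervalIntegrable_iff_integrableOn_Ioc_of_le hD.le).1 hI)] at h0
  have h1 : u =ᵐ[volume.restrict (Icc 0 D)] fun _ => 0 := by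
    rw [← Measure.restrict_congr_set (Ioo_ae_eq_Icc (a := (0 : ℝ)) (b := D))]
    rw [← Measure.restrict_congr_set (Ioo_ae_eq_Ioc (a := (0 : ℝ)) (b := D))] at h0
    filter_upwards [h0, ae_restrict_mem measurableSet_Ioo] with x hx hxI
    rcases mul_eq_zero.1 hx with h2 | h2
    · exact absurd h2 (density_pos hh hN hD hDK hxI).ne'
    · exact abs_eq_zero.1 ((Real.rpow_eq_zero (abs_nonneg _) (by linarith)).1 h2)
  exact Measure.eqOn_Icc_of_ae_eq volume hD.ne h1 hu.continuousOn continuousOn_const hx₀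

/-- There is an admissible function, of the form `x ↦ x - c`. -/
lemma exists_admissible {h : ℝ → ℝ} (hp : 1 < p) (hD : 0 < D)
    (hDK : (D : EReal) ≤ diamBound K N) (hh : h ∈ densities K N D) :
    ∃ u, Admissible p h u := by
  have ht := tsupport_eq_Icc hh hDK
  have hi := hh.1.integrable
  have hp1 : 0 < p - 1 := by linarith
  set ψ : ℝ → ℝ := fun c => ∫ x in 0..D, h x * ((x - c) * |x - c| ^ (p - 2)) with hψ
  have hcz := continuous_abs_rpow_mul_self hp
  have hψc : ContinuousOn ψ (Icc 0 D) := by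
    intro c hc
    refine intervalIntegral.continuousWithinAt_of_dominated_interval
      (bound := fun x => h x * D ^ (p - 1)) ?_ ?_ ?_ ?_
    · refine Filter.Eventually.of_forall fun c' => ?_
      refine (hh.1.measurable.mul ?_).aestronglyMeasurable
      exact (hcz.comp (continuous_id.sub continuous_const)).measurable
    · filter_upwards [self_mem_nhdsWithin] with c' hc'
      refine Filter.Eventually.of_forall fun x hx => ?_
      rw [uIoc_of_le hD.le] at hx
      rw [norm_mul, Real.norm_of_nonneg (hh.1.nonneg x), Real.norm_eq_abs, mul_comm (x - c'),
        abs_abs_rpow_sub_two_mul hp]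
      refine mul_le_mul_of_nonneg_left ?_ (hh.1.nonneg x)
      refine Real.rpow_le_rpow (abs_nonneg _) ?_ hp1.le
      rw [abs_le]
      constructor <;> linarith [hx.1, hx.2, hc'.1, hc'.2]
    · exact (hi.mul_const _).intervalIntegrable
    · refine Filter.Eventually.of_forall fun x _ => ?_
      have : Continuous fun c => h x * ((x - c) * |x - c| ^ (p - 2)) :=
        (hcz.comp (continuous_const.sub continuous_id)).const_mul (h x)
      exact this.continuousWithinAt
  have hψ0 : 0 ≤ ψ 0 := by
    refine intervalIntegral.integral_nonneg hD.le fun x hx => ?_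
    refine mul_nonneg (hh.1.nonneg x) (mul_nonneg ?_ (Real.rpow_nonneg (abs_nonneg _) _))
    linarith [hx.1]
  have hψD : ψ D ≤ 0 := by
    have : 0 ≤ -ψ D := by
      rw [hψ, ← intervalIntegral.integral_neg]
      refine intervalIntegral.integral_nonneg hD.le fun x hx => ?_
      rw [← mul_neg, ← neg_mul]
      refine mul_nonneg (hh.1.nonneg x) (mul_nonneg ?_ (Real.rpow_nonneg (abs_nonneg _) _))
      linarith [hx.2]
    linarith
  obtain ⟨c, hc, hc0⟩ := intermediate_value_Icc' hD.le hψc ⟨hψD, hψ0⟩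
  refine ⟨fun x => x - c, ⟨1, ?_⟩, ?_, ?_, ?_⟩
  · exact (LipschitzWith.of_dist_le_mul fun x y => by
      rw [dist_sub_right, NNReal.coe_one, one_mul]).lipschitzOnWith
  · have : IsFiniteMeasure (volume.withDensity fun x => ENNReal.ofReal (h x)) :=
      isFiniteMeasure_withDensity_ofReal hi.2
    refine MemLp.of_bound (C := D) (by fun_prop) ?_
    rw [ae_withDensity_iff hh.1.measurable.ennreal_ofReal]
    refine Filter.Eventually.of_forall fun x hx => ?_
    have hx' : x ∈ tsupport h := by
      by_contra hcon
      exact hx (by rw [image_eq_zero_of_notMem_tsupport hcon, ENNReal.ofReal_zero])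
    rw [ht] at hx'
    rw [Real.norm_eq_abs, abs_le]
    constructor <;> linarith [hx'.1, hx'.2, hc.1, hc.2]
  · rw [ht]
    rcases eq_or_ne c 0 with h0 | h0
    · exact ⟨D, ⟨hD.le, le_rfl⟩, by simpa [h0] using hD.ne'⟩
    · exact ⟨0, ⟨le_rfl, hD.le⟩, by simpa using h0⟩
  · rw [integral_mul_density_eq hD.le ht]
    exact hc0

/-- Every Rayleigh quotient is bounded below by the parameter of a phase reaching `π_p/2`. -/
lemma le_rayleigh (hp : 1 < p) (hN : 1 < N) (hD : 0 < D)
    (hDK : (D : EReal) ≤ diamBound K N) {α : ℝ} {φ : ℝ → ℝ} (hα : 0 < α)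
    (hφ : IsPhase (phaseF p) (fun x => cotKN K N x / (p - 1)) (D / 2) D α φ)
    (hφP : ∀ x ∈ Ico (D / 2) D, φ x < piP p / 2) {h : ℝ → ℝ} (hh : h ∈ densities K N D)
    {u : ℝ → ℝ} (hu : Admissible p h u) :
    (p - 1) * α ^ p ≤ (∫ x, |deriv u x| ^ p * h x) / (∫ x, |u x| ^ p * h x) := by
  have ht := tsupport_eq_Icc hh hDK
  obtain ⟨⟨C, hC⟩, -, ⟨x₀, hx₀, hux⟩, hmean⟩ := hu
  rw [ht] at hC hx₀
  -- `u` is arbitrary off `[0, D]`; a global Lipschitz extension has the same derivative on `(0,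
  -- D)`, the only place where it counts.
  obtain ⟨w, hw, huw⟩ := hC.extend_real
  have hd : ∫ x in 0..D, h x * |deriv u x| ^ p = ∫ x in 0..D, h x * |deriv w x| ^ p := by
    rw [intervalIntegral.integral_of_le hD.le, intervalIntegral.integral_of_le hD.le,
      integral_Ioc_eq_integral_Ioo, integral_Ioc_eq_integral_Ioo]
    refine setIntegral_congr_fun measurableSet_Ioo fun x hx => ?_
    have : u =ᶠ[nhds x] w := by
      filter_upwards [Icc_mem_nhds hx.1 hx.2] with y hy using huw hy
    simp only [this.deriv_eq]
  have hn : ∀ g : ℝ → ℝ, ∫ x in 0..D, h x * g (u x) = ∫ x in 0..D, h x * g (w x) := by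
    intro g
    refine intervalIntegral.integral_congr fun x hx => ?_
    rw [uIcc_of_le hD.le] at hx
    simp only [huw hx]
  rw [integral_mul_density_eq hD.le ht, hn fun z => z * |z| ^ (p - 2)] at hmean
  rw [integral_mul_density_eq hD.le ht, integral_mul_density_eq hD.le ht, hd,
    hn fun z => |z| ^ p,
    le_div_iff₀ (integral_mul_abs_rpow_pos hp hN hD hDK hh hw.continuous hx₀ (by
      rwa [← huw hx₀]))]
  have hwc : LipschitzWith C fun x => w x - w (D / 2) :=
    LipschitzWith.of_dist_le_mul fun x y => by
      rw [dist_sub_right]; exact hw.dist_le_mul x y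
  have h1 := integral_energy_nonneg hp hN hD hDK hα hφ hφP hh hwc (by simp)
  simp only [deriv_sub_const] at h1
  refine le_trans (mul_le_mul_of_nonneg_left ?_ ?_) h1
  · exact integral_rpow_le_integral_sub_rpow hp hD.le hh.1.nonneg hh.1.integrable hw.continuous
      hmean _
  · exact mul_nonneg (by linarith) (Real.rpow_nonneg hα.le _)

end Comparison

end MCPGap

theorem theorem3p9 (p K N D : ℝ) (hp : 1 < p) (hN : 1 < N) (hD : 0 < D)
    (hDK : (D : EReal) ≤ MCPGap.diamBound K N) :
    IsLeast (MCPGap.modelParameters p K N D) (MCPGap.lambdaHat p K N D) ∧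
    ∀ h ∈ MCPGap.densities K N D,
      MCPGap.lambdaHat p K N D ≤ MCPGap.spectralGap p h := by
  obtain ⟨α, φ, hα, hφ, hφP, hleast⟩ := MCPGap.exists_isLeast_modelParameters hp hN hD hDK
  have heq : MCPGap.lambdaHat p K N D = (p - 1) * α ^ p := hleast.csInf_eq
  rw [heq]
  refine ⟨hleast, fun h hh => ?_⟩
  -- The real infimum of the empty set is `0`, so the lower bound needs at least one admissible
  -- function.
  obtain ⟨u, hu⟩ := MCPGap.exists_admissible hp hD hDK hh
  refine le_csInf ⟨_, u, hu, rfl⟩ ?_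
  rintro q ⟨v, hv, rfl⟩
  exact MCPGap.le_rayleigh hp hN hD hDK hα hφ hφP hh hv
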